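/- Let $\mathcal D_2$ be the Dyck inverse monoid, that is, the monoid with zero with generators $\alpha_-(n),\alpha_+(n)$, $n\in\{0,1\}$, and relations $\alpha_-(n)\alpha_+(n)=\mathbf 1$ and $\alpha_-(n)\alpha_+(m)=0$ for $n\ne m$; let $\mathcal D_2^-$ (resp. $\mathcal D_2^+$) be its subsemigroup generated by the $\alpha_-(n)$ (resp. the $\alpha_+(n)$). Consider the directed graph with vertices $0,1$ and edges $\beta^-(0),\beta^+(0)$ from $0$ to $0$, $\beta^-$ and $\beta^+(1)$ from $0$ to $1$, and $\beta^-(1)$ and $\beta^+$ from $1$ to $0$, with labels $\lambda(\beta^\pm(n))=\alpha_\pm(n)$ and $\lambda(\beta^\pm)=\mathbf 1$, extended multiplicatively to paths. The Fibonacci-Dyck shift $F$ is the set of bi-infinite sequences of edges all of whose finite subwords are directed paths with non-zero label, with the shift map $S((x_i)_{i\in\mathbb Z})=(x_{i+1})_{i\in\mathbb Z}$. A multiplier is a primitive word in the symbols $\alpha(0),\alpha(1)$ (a word that is not a proper power of a word), up to cyclic permutation. A periodic point $p\in F$ of smallest period $\Pi(p)$, and its orbit, have negative (positive) multiplier if $\lambda((p_j)_{i\le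 j<i+\Pi(p)})$ lies in $\mathcal D_2^-$ ($\mathcal D_2^+$) for some $i\in\mathbb Z$. They have multiplier $\mu_-$ (resp. $\mu_+$) if for some $i$ this label is a positive power of $\alpha_-(n_1)\cdots\alpha_-(n_J)$ (resp. of $\alpha_+(n_J)\cdots\alpha_+(n_1)$) for a representative $\alpha(n_1)\cdots\alpha(n_J)$ of $\mu$. Let $\mathcal O_n^-$, $\mathcal O_n^+$, $\mathcal O_n(\mu_-)$, $\mathcal O_n(\mu_+)$ be the corresponding sets of periodic orbits of length $n$. The multiplier $\mu$ is exceptional at period $n\ge 1$ if $$\operatorname{card}\bigl(\mathcal O_n(\mu_-)\cup\mathcal O_n(\mu_+)\bigr)>\max\{\operatorname{card}\mathcal O_n^-,\operatorname{card}\mathcal O_n^+\}.$$ **Proposition M0.** For $n\ge1$, the multiplier $\alpha(0)$ of the Fibonacci-Dyck shift is exceptional at period $n$ if and only if $n\in\{1,3,5\}$. Moreover, for every $n\ge 7$ there is an injection $$\mathcal O_n(\alpha_-(0))\to\bigcup_{\mu\ne\alpha(0)}\mathcal O_n(\mu_-).$$ -/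

import Mathlib

namespace FibDyck

/-! ### The Dyck inverse monoid -/

/-- The generators `α₋(n)`, `α₊(n)`, `0 ≤ n < N`. -/
inductive DyckGen (N : ℕ) : Type
  | neg (n : Fin N) : DyckGen N
  | pos (n : Fin N) : DyckGen N

/-- The defining relations `α₋(n) α₊(n) = 1` and `α₋(n) α₊(m) = 0` for `n ≠ m`, in the free
monoid with zero on the generators. -/
inductive DyckRel (N : ℕ) :
    WithZero (FreeMonoid (DyckGen N)) → WithZero (FreeMonoid (DyckGen N)) → Prop
  | cancel (n : Fin N) :
      DyckRel N ((FreeMonoid.of (DyckGen.neg n) * FreeMonoid.of (DyckGen.pos n) :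
        FreeMonoid (DyckGen N)) : WithZero (FreeMonoid (DyckGen N))) 1
  | vanish (n m : Fin N) (h : n ≠ m) :
      DyckRel N ((FreeMonoid.of (DyckGen.neg n) * FreeMonoid.of (DyckGen.pos m) :
        FreeMonoid (DyckGen N)) : WithZero (FreeMonoid (DyckGen N))) 0

/-- The Dyck inverse monoid `𝒟_N`, by generators and relations (as a monoid with zero). -/
def DyckMonoid (N : ℕ) : Type := (conGen (DyckRel N)).Quotient

instance (N : ℕ) : Monoid (DyckMonoid N) :=
  inferInstanceAs (Monoid (conGen (DyckRel N)).Quotient)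

/-- The quotient map from the free monoid with zero. -/
def DyckMonoid.mk (N : ℕ) : WithZero (FreeMonoid (DyckGen N)) →* DyckMonoid N :=
  (conGen (DyckRel N)).mk'

instance (N : ℕ) : Zero (DyckMonoid N) := ⟨DyckMonoid.mk N 0⟩

/-- The generator `α₋(n)` of `𝒟_N`. -/
def alphaNeg {N : ℕ} (n : Fin N) : DyckMonoid N :=
  DyckMonoid.mk N ((FreeMonoid.of (DyckGen.neg n) : FreeMonoid (DyckGen N)) :
    WithZero (FreeMonoid (DyckGen N)))

/-- The generator `α₊(n)` of `𝒟_N`. -/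
def alphaPos {N : ℕ} (n : Fin N) : DyckMonoid N :=
  DyckMonoid.mk N ((FreeMonoid.of (DyckGen.pos n) : FreeMonoid (DyckGen N)) :
    WithZero (FreeMonoid (DyckGen N)))

/-- `∏_{1 ≤ j ≤ J} α₋(n_j)` for a word `(n_j)_{1 ≤ j ≤ J}`. -/
def negProd {N : ℕ} (w : List (Fin N)) : DyckMonoid N := (w.map alphaNeg).prod

/-- `∏_{J ≥ j ≥ 1} α₊(n_j)` for a word `(n_j)_{1 ≤ j ≤ J}`. -/
def posProd {N : ℕ} (w : List (Fin N)) : DyckMonoid N := (w.reverse.map alphaPos).prod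

/-- The semigroup `𝒟_N⁻` generated by the `α₋(n)` (it does not contain `1`). -/
def negPart (N : ℕ) : Subsemigroup (DyckMonoid N) := Subsemigroup.closure (Set.range alphaNeg)

/-- The semigroup `𝒟_N⁺` generated by the `α₊(n)` (it does not contain `1`). -/
def posPart (N : ℕ) : Subsemigroup (DyckMonoid N) := Subsemigroup.closure (Set.range alphaPos)

/-! ### Multipliers -/

/-- A word is primitive if it is not a proper power of a word. (The empty word is not
primitive, because it is its own square.) -/
def IsPrimitive {A : Type*} (w : List A) : Prop :=
  ∀ (u : List A) (k : ℕ), w = (List.replicate k u).flatten → k = 1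

/-- Multipliers: classes of primitive words in the symbols `α(n)`, `0 ≤ n < N`, up to cyclic
permutation. -/
def Multiplier (N : ℕ) : Type :=
  {c : Cycle (Fin N) // ∃ w : List (Fin N), IsPrimitive w ∧ (w : Cycle (Fin N)) = c}

/-- The word `w` is a representative of the multiplier `μ`. -/
def Multiplier.IsRep {N : ℕ} (μ : Multiplier N) (w : List (Fin N)) : Prop :=
  (w : Cycle (Fin N)) = μ.1

theorem isPrimitive_singleton {A : Type*} (a : A) : IsPrimitive [a] := by
  intro u k h
  have h1 := congrArg List.length h
  simp only [List.length_cons, List.length_nil, List.length_flatten, List.map_replicate,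
    List.sum_replicate, smul_eq_mul] at h1
  exact Nat.eq_one_of_mul_eq_one_right h1.symm

/-- The multiplier `α(n)`, the class of a word of length one. -/
def alpha {N : ℕ} (n : Fin N) : Multiplier N :=
  ⟨(([n] : List (Fin N)) : Cycle (Fin N)), [n], isPrimitive_singleton n, rfl⟩

/-! ### Labelled graphs and their shifts -/

/-- The shift `S((x_i)) = (x_{i+1})` on the bi-infinite sequences. -/
def shift {E : Type} (x : ℤ → E) : ℤ → E := fun i => x (i + 1)

/-- The word `(x_j)_{i ≤ j < i + n}`. -/
def block {E : Type} (x : ℤ → E) (i : ℤ) (n : ℕ) : List E :=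
  (List.range n).map fun k => x (i + (k : ℤ))

/-- A directed graph with vertex set `V` and edge set `E` whose edges carry labels in `𝒟_N`. -/
structure LabelledGraph (N : ℕ) (V E : Type) where
  source : E → V
  target : E → V
  label : E → DyckMonoid N

namespace LabelledGraph

variable {N : ℕ} {V E : Type} (G : LabelledGraph N V E)

/-- The label map, extended multiplicatively to words in the edges. -/
def labelWord (b : List E) : DyckMonoid N := (b.map G.label).prod

/-- Directed paths in the graph. -/
def IsPath (b : List E) : Prop := b.IsChain fun e f => G.target e = G.source f

/-- The shift `X(V, E, λ)`: the sequences all of whose finite words are directed paths with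
non-zero label. -/
def shiftSpace : Set (ℤ → E) :=
  {x | ∀ (i : ℤ) (n : ℕ), G.IsPath (block x i n) ∧ G.labelWord (block x i n) ≠ 0}

/-- The periodic points of the shift with smallest period `n` (to be used for `n ≥ 1`). -/
def periodicPoints (n : ℕ) : Set (ℤ → E) :=
  {p | p ∈ G.shiftSpace ∧ p ∈ Function.periodicPts shift ∧ Function.minimalPeriod shift p = n}

/-- The label of the word `(p_j)_{i ≤ j < i + Π(p)}`, where `Π(p)` is the period of `p`. -/
noncomputable def periodLabel (p : ℤ → E) (i : ℤ) : DyckMonoid N :=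
  G.labelWord (block p i (Function.minimalPeriod shift p))

/-- `p` has negative multiplier. -/
def HasNeg (p : ℤ → E) : Prop := ∃ i : ℤ, G.periodLabel p i ∈ negPart N

/-- `p` has positive multiplier. -/
def HasPos (p : ℤ → E) : Prop := ∃ i : ℤ, G.periodLabel p i ∈ posPart N

/-- `p` has multiplier `μ₋`: over a period its label is a power of the product of the `α₋`
along a representative of `μ`. -/
def HasNegMultiplier (μ : Multiplier N) (p : ℤ → E) : Prop :=
  ∃ (i : ℤ) (w : List (Fin N)) (k : ℕ),
    μ.IsRep w ∧ 1 ≤ k ∧ G.periodLabel p i = negProd w ^ k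

/-- `p` has multiplier `μ₊`: over a period its label is a power of the reversed product of the
`α₊` along a representative of `μ`. -/
def HasPosMultiplier (μ : Multiplier N) (p : ℤ → E) : Prop :=
  ∃ (i : ℤ) (w : List (Fin N)) (k : ℕ),
    μ.IsRep w ∧ 1 ≤ k ∧ G.periodLabel p i = posProd w ^ k

/-- The set `𝒪_n⁻` of periodic orbits of length `n` with negative multiplier. -/
def orbitsNeg (n : ℕ) : Set (Cycle (ℤ → E)) :=
  Function.periodicOrbit shift '' {p | p ∈ G.periodicPoints n ∧ G.HasNeg p}

/-- The set `𝒪_n⁺` of periodic orbits of length `n` with positive multiplier. -/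
def orbitsPos (n : ℕ) : Set (Cycle (ℤ → E)) :=
  Function.periodicOrbit shift '' {p | p ∈ G.periodicPoints n ∧ G.HasPos p}

/-- The set `𝒪_n(μ₋)` of periodic orbits of length `n` with multiplier `μ₋`. -/
def orbitsNegMultiplier (n : ℕ) (μ : Multiplier N) : Set (Cycle (ℤ → E)) :=
  Function.periodicOrbit shift '' {p | p ∈ G.periodicPoints n ∧ G.HasNegMultiplier μ p}

/-- The set `𝒪_n(μ₊)` of periodic orbits of length `n` with multiplier `μ₊`. -/
def orbitsPosMultiplier (n : ℕ) (μ : Multiplier N) : Set (Cycle (ℤ → E)) :=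
  Function.periodicOrbit shift '' {p | p ∈ G.periodicPoints n ∧ G.HasPosMultiplier μ p}

/-- The multiplier `μ` is exceptional at period `n`:
`card (𝒪_n(μ₋) ∪ 𝒪_n(μ₊)) > max {card 𝒪_n⁻, card 𝒪_n⁺}`. -/
def IsExceptionalAt (μ : Multiplier N) (n : ℕ) : Prop :=
  (G.orbitsNegMultiplier n μ ∪ G.orbitsPosMultiplier n μ).encard >
    max (G.orbitsNeg n).encard (G.orbitsPos n).encard

end LabelledGraph

/-! ### The Fibonacci-Dyck shift -/

/-- The edges `β⁻(0), β⁻, β⁻(1)` of the copy of the Fibonacci graph and the edges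
`β⁺(0), β⁺, β⁺(1)` of its reversal. -/
inductive FibEdge : Type
  | neg0 | neg | neg1 | pos0 | pos | pos1

/-- The labelled graph that presents the Fibonacci-Dyck shift. In the Fibonacci graph `β(0)` is
a loop at `0`, `β` goes from `0` to `1`, and `β(1)` goes from `1` to `0`. -/
def fibDyck : LabelledGraph 2 (Fin 2) FibEdge where
  source
    | .neg0 => 0
    | .neg => 0
    | .neg1 => 1
    | .pos0 => 0
    | .pos => 1
    | .pos1 => 0
  target
    | .neg0 => 0
    | .neg => 1
    | .neg1 => 0
    | .pos0 => 0
    | .pos => 0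
    | .pos1 => 1
  label
    | .neg0 => alphaNeg 0
    | .neg => 1
    | .neg1 => alphaNeg 1
    | .pos0 => alphaPos 0
    | .pos => 1
    | .pos1 => alphaPos 1

end FibDyck

namespace FibDyck

/-! Read a path as a stack machine: negative edges push, `β⁺(0)` and `β⁺(1)` pop, `β^±` only move
between the vertices. If the label over a period is a nonempty product of `α₋`'s, cut the orbit just
after an unmatched push. Both pushing edges end at `0`, so the period word becomes a closed path at
`0` that runs from the empty stack and leaves the unmatched symbols on it (`exists_good`). Such a
word factors uniquely into tokens: an unmatched push `A`, a matched pair `P w`, an excursion to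
vertex `1` with label `1` (`X l`), or an excursion ending in an unmatched `β⁻(1)` (`Y l`). A suffix
starting strictly inside a token cannot run from the empty stack at `0` (`enc_cut`), so rotations of
words lift to rotations of token lists. Hence negative orbits of length `n` are primitive token
lists of total length `n` containing an `A` or a `Y`, up to rotation (`Good`), and multiplier
`α₋(0)` means that no `Y` occurs.

For `n ∉ {1, 3, 5}` the lists without `Y` inject into those with a `Y`. If an `X` occurs, turn every
`X l` into `Y l`, which has the same length and can be undone. Otherwise only `A` and `P` occur.
Primitivity and `n ≠ 1` exclude lists of `A` alone, so some rotation starts with `A, P W`. This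
beginning is rewritten, at equal length, into a list with both an `X` and a `Y`, by cases on the
next token or, when the list is just `[A, P W]`, on the tokens of `W`. The only `W` without a rule
have length `0` or `2`, that is `n = 3` or `n = 5`. Each image keeps a token kind that occurs once
and stands first; it pins down the rotation and gives primitivity (`Img.injective`, `exists_img`).

So `𝒪_n(α₋(0))` and its image are disjoint parts of `𝒪_n⁻`, and `2 card 𝒪_n(α₋(0)) ≤ card 𝒪_n⁻`.
Time reversal gives `card 𝒪_n(α₊(0)) = card 𝒪_n(α₋(0))`, so `α(0)` is not exceptional
(`not_isExceptionalAt`). For `n = 1, 3, 5` enumeration gives at least `1, 2, 9` orbits in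
`𝒪_n(α₋(0))` and at most `1, 3, 16` in `𝒪_n⁻`. Negative and positive orbits are disjoint, because
the stack height changes over a period with opposite signs, so `2 > 1`, `4 > 3` and `18 > 16` give
exceptionality. -/

instance : DecidableEq FibEdge := fun a b => by
  cases a <;> cases b <;> first | exact isTrue rfl | exact isFalse (by simp)

/-! ### The stack machine -/

/-- A vertex of the graph together with a stack of unmatched symbols (top first). -/
abbrev State := Fin 2 × List (Fin 2)

/-- One step of the stack machine: the negative edges push, the positive edges pop. -/
def step : FibEdge → State → Option State
  | .neg0, q => if q.1 = 0 then some (0, 0 :: q.2) else none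
  | .neg, q => if q.1 = 0 then some (1, q.2) else none
  | .neg1, q => if q.1 = 1 then some (0, 1 :: q.2) else none
  | .pos0, q => if q.1 = 0 ∧ q.2.head? = some 0 then some (0, q.2.tail) else none
  | .pos, q => if q.1 = 1 then some (0, q.2) else none
  | .pos1, q => if q.1 = 0 ∧ q.2.head? = some 1 then some (1, q.2.tail) else none

/-- The stack machine on words. -/
def run : List FibEdge → State → Option State
  | [], q => some q
  | e :: b, q => (step e q).bind (run b)

@[simp] theorem run_nil (q : State) : run [] q = some q := rfl

@[simp] theorem run_cons (e : FibEdge) (b : List FibEdge) (q : State) :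
    run (e :: b) q = (step e q).bind (run b) := rfl

theorem run_append (a b : List FibEdge) (q : State) :
    run (a ++ b) q = (run a q).bind (run b) := by
  induction a generalizing q with
  | nil => rfl
  | cons e a ih =>
    simp only [List.cons_append, run_cons, Option.bind_assoc]
    congr 1
    funext q
    exact ih q

theorem step_stack {e : FibEdge} {v v' : Fin 2} {s s' : List (Fin 2)}
    (h : step e (v, s) = some (v', s')) (t : List (Fin 2)) :
    step e (v, s ++ t) = some (v', s' ++ t) := by
  cases e <;> cases s <;> simp_all [step] <;> grind

theorem run_stack {b : List FibEdge} {v v' : Fin 2} {s s' : List (Fin 2)}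
    (h : run b (v, s) = some (v', s')) (t : List (Fin 2)) :
    run b (v, s ++ t) = some (v', s' ++ t) := by
  induction b generalizing v s with
  | nil => simp_all
  | cons e b ih =>
    obtain ⟨⟨v1, s1⟩, h1, h2⟩ := Option.bind_eq_some_iff.1 h
    simp [step_stack h1 t, ih h2]

theorem run_stack_nil {b : List FibEdge} {v v' : Fin 2} {s' : List (Fin 2)}
    (h : run b (v, []) = some (v', s')) (t : List (Fin 2)) :
    run b (v, t) = some (v', s' ++ t) := run_stack h t

theorem step_under {e : FibEdge} {v v1 : Fin 2} {s t s1 : List (Fin 2)} {a : Fin 2}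
    (h : step e (v, s ++ a :: t) = some (v1, s1)) :
    (∃ s', step e (v, s) = some (v1, s') ∧ s1 = s' ++ a :: t) ∨
      (s = [] ∧ step e (v, [a]) = some (v1, []) ∧ s1 = t) := by
  cases e <;> cases s <;> simp_all [step] <;> grind

/-- Either the symbol `a` below the stack `s` is never popped, or there is a first position
where it is popped. -/
theorem run_under {b : List FibEdge} {v v' : Fin 2} {s t u : List (Fin 2)} {a : Fin 2}
    (h : run b (v, s ++ a :: t) = some (v', u)) :
    (∃ u', run b (v, s) = some (v', u') ∧ u = u' ++ a :: t) ∨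
      ∃ b1 e b2 v1 v2, b = b1 ++ e :: b2 ∧ run b1 (v, s) = some (v1, []) ∧
        step e (v1, [a]) = some (v2, []) ∧ run b2 (v2, t) = some (v', u) := by
  induction b generalizing v s with
  | nil => left; simp_all
  | cons e b ih =>
    obtain ⟨⟨v1, s1⟩, h1, h2⟩ := Option.bind_eq_some_iff.1 h
    rcases step_under h1 with ⟨s', h3, rfl⟩ | ⟨rfl, h3, rfl⟩
    · rcases ih h2 with ⟨u', h4, h5⟩ | ⟨b1, e', b2, v3, v2, rfl, h5, h6, h7⟩
      · exact .inl ⟨u', by simp [h3, h4], h5⟩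
      · exact .inr ⟨e :: b1, e', b2, v3, v2, rfl, by simp [h3, h5], h6, h7⟩
    · exact .inr ⟨[], e, b, v, v1, rfl, rfl, h3, h2⟩

theorem step_source {e : FibEdge} {v v' : Fin 2} {s s' : List (Fin 2)}
    (h : step e (v, s) = some (v', s')) : fibDyck.source e = v := by
  cases e <;> simp_all [step, fibDyck]

theorem step_target {e : FibEdge} {v v' : Fin 2} {s s' : List (Fin 2)}
    (h : step e (v, s) = some (v', s')) : fibDyck.target e = v' := by
  cases e <;> simp_all [step, fibDyck]

/-- If a word runs both from a stack and from the empty stack, and ends with an empty stack in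
the first run, then so does it in the second one. -/
theorem run_empty_of_run {b : List FibEdge} {v w v' : Fin 2} {s : List (Fin 2)}
    (hb : b ≠ []) (h : run b (v, s) = some (v', [])) (h' : run b (w, []) ≠ none) :
    v = w ∧ s = [] := by
  obtain ⟨⟨w', u⟩, h'⟩ := Option.ne_none_iff_exists'.1 h'
  have hvw : v = w := by
    cases b with
    | nil => exact absurd rfl hb
    | cons e b =>
      obtain ⟨_, h1, _⟩ := Option.bind_eq_some_iff.1 h
      obtain ⟨_, h2, _⟩ := Option.bind_eq_some_iff.1 h'
      exact (step_source h1).symm.trans (step_source h2)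
  subst hvw
  have := run_stack_nil h' s
  rw [h] at this
  simp_all

/-! ### Tokens -/

/-- Words that are closed paths at the vertex `0` with label `1`. -/
abbrev Neut : Type := {w : List FibEdge // run w (0, []) = some (0, [])}

theorem Neut.run_eq (w : Neut) (s : List (Fin 2)) : run w.1 (0, s) = some (0, s) :=
  run_stack_nil w.2 s

/-- The irreducible pieces of a closed path at `0` whose label is a product of `α₋`'s: an
unmatched `β⁻(0)`, a matched pair `β⁻(0) w β⁺(0)`, and the excursions to the vertex `1`, which
end either with `β⁺` or with an unmatched `β⁻(1)`. -/
inductive Tok : Type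
  | A
  | P (w : Neut)
  | X (l : List Neut)
  | Y (l : List Neut)

/-- The closed path at `1` given by a list of matched pairs `β⁻(1) w β⁺(1)`. -/
def loopEnc (l : List Neut) : List FibEdge := l.flatMap fun w => .neg1 :: (w.1 ++ [.pos1])

/-- The word of a token. -/
def Tok.enc : Tok → List FibEdge
  | A => [.neg0]
  | P w => .neg0 :: (w.1 ++ [.pos0])
  | X l => .neg :: (loopEnc l ++ [.pos])
  | Y l => .neg :: (loopEnc l ++ [.neg1])

/-- The unmatched symbols of a token. -/
def Tok.val : Tok → List (Fin 2)
  | A => [0]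
  | P _ => []
  | X _ => []
  | Y _ => [1]

/-- The word of a list of tokens. -/
def enc (s : List Tok) : List FibEdge := s.flatMap Tok.enc

@[simp] theorem enc_nil : enc [] = [] := rfl
@[simp] theorem enc_cons (t : Tok) (s : List Tok) : enc (t :: s) = t.enc ++ enc s := rfl
@[simp] theorem enc_append (s t : List Tok) : enc (s ++ t) = enc s ++ enc t := by
  simp [enc]
@[simp] theorem loopEnc_nil : loopEnc [] = [] := rfl
@[simp] theorem loopEnc_cons (w : Neut) (l : List Neut) :
    loopEnc (w :: l) = .neg1 :: (w.1 ++ .pos1 :: loopEnc l) := by simp [loopEnc]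

theorem run_loopEnc (l : List Neut) (s : List (Fin 2)) :
    run (loopEnc l) (1, s) = some (1, s) := by
  induction l with
  | nil => rfl
  | cons w l ih => simp [step, run_append, w.run_eq, ih]

theorem Tok.run_enc (t : Tok) (s : List (Fin 2)) : run t.enc (0, s) = some (0, t.val ++ s) := by
  cases t <;> simp [Tok.enc, Tok.val, step, run_append, Neut.run_eq, run_loopEnc]

theorem run_enc (s : List Tok) (u : List (Fin 2)) :
    run (enc s) (0, u) = some (0, (s.flatMap Tok.val).reverse ++ u) := by
  induction s generalizing u with
  | nil => rfl
  | cons t s ih =>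
    simp only [enc_cons, run_append, Tok.run_enc, Option.bind_some, ih, List.flatMap_cons,
      List.reverse_append, List.append_assoc]
    cases t <;> rfl

theorem Tok.enc_ne_nil (t : Tok) : t.enc ≠ [] := by cases t <;> simp [Tok.enc]

/-! ### Existence of the decomposition into tokens -/

/-- From vertex `1` the path either leaves by `β⁺` or pushes by `β⁻(1)`. An unmatched push ends the
excursion, while a matched one is popped by `β⁺(1)`, which leads back to `1`, and the argument
repeats on a shorter word. -/
theorem exists_loopEnc (n : ℕ) (b : List FibEdge) (hn : b.length ≤ n) (u : List (Fin 2))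
    (h : run b (1, []) = some (0, u)) :
    ∃ l b2 u', (b = loopEnc l ++ .pos :: b2 ∨ b = loopEnc l ++ .neg1 :: b2) ∧
      run b2 (0, []) = some (0, u') := by
  induction n generalizing b with
  | zero =>
    obtain rfl : b = [] := by simpa using hn
    simp at h
  | succ n ih =>
    cases b with
    | nil => simp at h
    | cons e b =>
      cases e <;> simp [step] at h
      case neg1 =>
        rcases run_under (s := []) h with ⟨u', h1, h2⟩ | ⟨b1, e, b2, v1, v2, rfl, h2, h3, h4⟩
        · exact ⟨[], b, u', .inr rfl, h1⟩
        · cases e <;> simp [step] at h3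
          obtain ⟨rfl, rfl⟩ := h3
          obtain ⟨l, b3, u', h5, h6⟩ := ih b2 (by simp at hn; omega) h4
          refine ⟨⟨b1, h2⟩ :: l, b3, u', ?_, h6⟩
          rcases h5 with rfl | rfl
          · exact .inl (by rw [loopEnc_cons]; simp)
          · exact .inr (by rw [loopEnc_cons]; simp)
      case pos => exact ⟨[], b, u, .inl rfl, h⟩

theorem exists_enc (b : List FibEdge) (u : List (Fin 2)) (h : run b (0, []) = some (0, u)) :
    ∃ s, enc s = b := by
  induction hn : b.length using Nat.strong_induction_on generalizing b u with
  | _ n ih =>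
  cases b with
  | nil => exact ⟨[], rfl⟩
  | cons e b =>
    cases e <;> simp [step] at h
    case neg0 =>
      rcases run_under (s := []) h with ⟨u', h1, h2⟩ | ⟨b1, e, b2, v1, v2, rfl, h2, h3, h4⟩
      · obtain ⟨s, rfl⟩ := ih _ (by simp at hn; omega) b u' h1 rfl
        exact ⟨.A :: s, rfl⟩
      · cases e <;> simp [step] at h3
        obtain ⟨rfl, rfl⟩ := h3
        obtain ⟨s, rfl⟩ := ih _ (by simp at hn; omega) b2 u h4 rfl
        exact ⟨.P ⟨b1, h2⟩ :: s, by simp [Tok.enc]⟩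
    case neg =>
      obtain ⟨l, b2, u', h5, h6⟩ := exists_loopEnc _ b le_rfl u h
      rcases h5 with rfl | rfl
      · obtain ⟨s, rfl⟩ := ih _ (by simp at hn; omega) b2 u' h6 rfl
        exact ⟨.X l :: s, by simp [Tok.enc]⟩
      · obtain ⟨s, rfl⟩ := ih _ (by simp at hn; omega) b2 u' h6 rfl
        exact ⟨.Y l :: s, by simp [Tok.enc]⟩

/-! ### Uniqueness of the decomposition into tokens -/

theorem run_suffix_ne_none {a b : List FibEdge} {q : State} (h : run (a ++ b) q ≠ none) :
    run a q ≠ none := by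
  intro h'
  simp [run_append, h'] at h

/-- A proper suffix of a neutral word followed by a popping edge does not run from the empty
stack at `0`. -/
theorem Neut.run_suffix_pop {w : Neut} {b c r : List FibEdge} {e : FibEdge}
    (he : e = .pos0 ∨ e = .pos1) (hw : w.1 = b ++ c) : run (c ++ e :: r) (0, []) = none := by
  by_contra hne
  rcases eq_or_ne c [] with rfl | hc
  · rcases he with rfl | rfl <;> simp [step] at hne
  · have h1 := w.2
    rw [hw, run_append] at h1
    obtain ⟨⟨v, s⟩, h2, h3⟩ := Option.bind_eq_some_iff.1 h1
    obtain ⟨rfl, rfl⟩ := run_empty_of_run hc h3 (run_suffix_ne_none hne)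
    rw [run_append, h3] at hne
    rcases he with rfl | rfl <;> simp [step] at hne

/-- A suffix starting between two loops starts at vertex `1`. One starting inside a loop meets the
pop `β⁺(1)` with nothing to pop. -/
theorem loopEnc_suffix (l : List Neut) (b c r : List FibEdge) (e : FibEdge)
    (he : e = .pos ∨ e = .neg1) (h : loopEnc l = b ++ c) :
    run (c ++ e :: r) (0, []) = none := by
  induction l generalizing b with
  | nil =>
    obtain ⟨rfl, rfl⟩ : b = [] ∧ c = [] := by simpa using h.symm
    rcases he with rfl | rfl <;> simp [step]
  | cons w l ih =>
    rw [loopEnc_cons] at h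
    cases b with
    | nil =>
      rw [List.nil_append] at h
      subst h
      simp [step]
    | cons x b =>
      simp only [List.cons_append, List.cons.injEq] at h
      rcases List.append_eq_append_iff.1 h.2 with ⟨a', rfl, h2⟩ | ⟨c', h1, rfl⟩
      · cases a' with
        | nil =>
          rw [List.nil_append] at h2
          subst h2
          simp [step]
        | cons y a' =>
          simp only [List.cons_append, List.cons.injEq] at h2
          exact ih a' h2.2
      · have := Neut.run_suffix_pop (r := loopEnc l ++ e :: r) (.inr rfl) h1
        simpa using this

/-- After the first edge of a token the path is at vertex `1` or above a pushed symbol that the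
token itself pops later. Neither can be continued from the empty stack at `0`. This makes token
boundaries recognizable. -/
theorem Tok.run_suffix (t : Tok) {b c r : List FibEdge} (h : t.enc = b ++ c) (hb : b ≠ [])
    (hc : c ≠ []) : run (c ++ r) (0, []) = none := by
  obtain ⟨x, b, rfl⟩ := List.exists_cons_of_ne_nil hb
  obtain ⟨c, y, rfl⟩ : ∃ c' y, c = c' ++ [y] := ⟨_, _, (List.dropLast_append_getLast hc).symm⟩
  cases t with
  | A => simp [Tok.enc] at h
  | P w =>
    simp only [Tok.enc, List.cons_append, List.cons.injEq, ← List.append_assoc] at h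
    obtain ⟨h1, h2⟩ := List.append_inj' h.2 rfl
    simp only [List.cons.injEq, and_true] at h2
    subst h2
    simpa using Neut.run_suffix_pop (r := r) (.inl rfl) h1
  | X l =>
    simp only [Tok.enc, List.cons_append, List.cons.injEq, ← List.append_assoc] at h
    obtain ⟨h1, h2⟩ := List.append_inj' h.2 rfl
    simp only [List.cons.injEq, and_true] at h2
    subst h2
    simpa using loopEnc_suffix l b c r _ (.inl rfl) h1
  | Y l =>
    simp only [Tok.enc, List.cons_append, List.cons.injEq, ← List.append_assoc] at h
    obtain ⟨h1, h2⟩ := List.append_inj' h.2 rfl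
    simp only [List.cons.injEq, and_true] at h2
    subst h2
    simpa using loopEnc_suffix l b c r _ (.inr rfl) h1

/-- A suffix of the word of a token list that runs from the empty stack at `0` starts at a
boundary of tokens. -/
theorem enc_cut {s : List Tok} {b c : List FibEdge} (h : enc s = b ++ c)
    (hc : run c (0, []) ≠ none) : ∃ s1 s2, s = s1 ++ s2 ∧ enc s1 = b ∧ enc s2 = c := by
  induction s generalizing b with
  | nil =>
    obtain ⟨rfl, rfl⟩ : b = [] ∧ c = [] := by simpa using h.symm
    exact ⟨[], [], rfl, rfl, rfl⟩
  | cons t s ih =>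
    rw [enc_cons] at h
    rcases List.append_eq_append_iff.1 h with ⟨a', rfl, h2⟩ | ⟨c', h1, rfl⟩
    · obtain ⟨s1, s2, rfl, rfl, rfl⟩ := ih h2
      exact ⟨t :: s1, s2, rfl, rfl, rfl⟩
    · rcases eq_or_ne b [] with rfl | hb
      · exact ⟨[], t :: s, rfl, rfl, by simp [h1]⟩
      · rcases eq_or_ne c' [] with rfl | hc'
        · exact ⟨[t], s, rfl, by simp [h1], rfl⟩
        · exact absurd (t.run_suffix h1 hb hc') hc

theorem enc_run_ne_none (s : List Tok) : run (enc s) (0, []) ≠ none := by simp [run_enc]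

theorem loopEnc_injective : Function.Injective loopEnc := by
  intro l l' h
  induction l generalizing l' with
  | nil => cases l' <;> simp_all
  | cons w l ih =>
    cases l' with
    | nil => simp at h
    | cons w' l' =>
      simp only [loopEnc_cons, List.cons.injEq, true_and] at h
      -- If one neutral word properly extended another, its next edge would be `β⁺(1)`, a pop from
      -- the empty stack.
      have key : ∀ (w w' : Neut) (r r' a : List FibEdge), w.1 = w'.1 ++ a →
          .pos1 :: r' = a ++ .pos1 :: r → a = [] := by
        intro w w' r r' a h1 h2
        by_contra ha
        obtain ⟨x, a, rfl⟩ := List.exists_cons_of_ne_nil ha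
        simp only [List.cons_append, List.cons.injEq] at h2
        have := w.2
        rw [h1, run_append, w'.2, ← h2.1] at this
        simp [step] at this
      have hw : w.1 = w'.1 := by
        rcases List.append_eq_append_iff.1 h with ⟨a', h1, h2⟩ | ⟨c', h1, h2⟩
        · obtain rfl := key _ _ _ _ _ h1 h2
          simpa using h1.symm
        · obtain rfl := key _ _ _ _ _ h1 h2
          simpa using h1
      rw [hw] at h
      simp only [List.append_cancel_left_eq, List.cons.injEq, true_and] at h
      rw [ih h, Subtype.ext hw]

theorem Tok.enc_injective : Function.Injective Tok.enc := by
  intro t t' h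
  cases t <;> cases t' <;> simp only [Tok.enc, List.cons.injEq, true_and, reduceCtorEq,
    false_and] at h ⊢
  case A.P => simp at h
  case P.A => simp at h
  case P.P w w' => rw [Subtype.ext (List.append_inj' h rfl).1]
  case X.X => rw [loopEnc_injective (List.append_inj' h rfl).1]
  case X.Y => simpa using (List.append_inj' h rfl).2
  case Y.X => simpa using (List.append_inj' h rfl).2
  case Y.Y => rw [loopEnc_injective (List.append_inj' h rfl).1]

/-- `enc_cut` is applied twice: once to find where the tail `s` starts in the other list, and once
to see that the part before it, which encodes the single token `t`, cannot be cut further. -/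
theorem enc_injective : Function.Injective enc := by
  intro s s' h
  induction s generalizing s' with
  | nil =>
    cases s' with
    | nil => rfl
    | cons t s' => simp [t.enc_ne_nil] at h
  | cons t s ih =>
    rw [enc_cons] at h
    obtain ⟨s1, s2, rfl, h1, h2⟩ := enc_cut h.symm (enc_run_ne_none s)
    cases s1 with
    | nil => exact absurd h1.symm t.enc_ne_nil
    | cons t' s1 =>
      have h3 : enc [t] = t'.enc ++ enc s1 := by simpa using h1.symm
      obtain ⟨a, b, h4, h5, h6⟩ := enc_cut h3 (enc_run_ne_none s1)
      rcases List.append_eq_cons_iff.1 h4.symm with ⟨rfl, rfl⟩ | ⟨a', rfl, h7⟩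
      · exact absurd h5.symm t'.enc_ne_nil
      · obtain ⟨rfl, rfl⟩ : a' = [] ∧ b = [] := by simpa using h7.symm
        have h8 : t.enc = t'.enc := by simpa using h5
        have : s1 = [] := by
          cases s1 with
          | nil => rfl
          | cons x s1 => simp [x.enc_ne_nil] at h6
        subst this
        rw [Tok.enc_injective h8, ih h2.symm]
        rfl

/-- Rotated words come from rotated token lists. -/
theorem enc_rotate {s s' : List Tok} {b c : List FibEdge} (h : enc s = b ++ c)
    (h' : enc s' = c ++ b) :
    ∃ s1 s2, s = s1 ++ s2 ∧ s' = s2 ++ s1 ∧ enc s1 = b ∧ enc s2 = c := by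
  have hc : run c (0, []) ≠ none := run_suffix_ne_none (b := b) (h' ▸ enc_run_ne_none s')
  obtain ⟨s1, s2, rfl, rfl, rfl⟩ := enc_cut h hc
  exact ⟨s1, s2, rfl, enc_injective (by simpa using h'), rfl, rfl⟩

/-! ### Token lists up to rotation -/

namespace Tok

/-- The token is an unmatched `β⁻(0)`. -/
def isA : Tok → Bool
  | A => true
  | P _ => false
  | X _ => false
  | Y _ => false

/-- The token is an excursion to the vertex `1` with label `1`. -/
def isX : Tok → Bool
  | A => false
  | P _ => false
  | X _ => true
  | Y _ => false

/-- The token is an excursion to the vertex `1` with label `α₋(1)`. -/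
def isY : Tok → Bool
  | A => false
  | P _ => false
  | X _ => false
  | Y _ => true

/-- Make the final edge of an excursion an unmatched `β⁻(1)`. -/
def toY : Tok → Tok
  | A => A
  | P w => P w
  | X l => Y l
  | Y l => Y l

/-- Make the final edge of an excursion `β⁺`. -/
def toX : Tok → Tok
  | A => A
  | P w => P w
  | X l => X l
  | Y l => X l

end Tok

open Tok

/-- All tokens of the list have label `1`. -/
def Neutral (s : List Tok) : Prop := ∀ t ∈ s, t.isA = false ∧ t.isY = false

theorem exists_enc_neut (w : Neut) : ∃ s, enc s = w.1 ∧ Neutral s := by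
  obtain ⟨s, hs⟩ := exists_enc w.1 [] w.2
  refine ⟨s, hs, fun t ht => ?_⟩
  have h := run_enc s []
  rw [hs, w.2] at h
  have h' := congrArg Prod.snd (Option.some.inj h)
  simp only [List.append_nil] at h'
  have h2 := List.flatMap_eq_nil_iff.1 (List.reverse_eq_nil_iff.1 h'.symm) t ht
  cases t <;> simp_all [isA, isY, Tok.val]

theorem isRotated_iff_append {α : Type*} {s s' : List α} :
    s ~r s' ↔ ∃ s1 s2, s = s1 ++ s2 ∧ s' = s2 ++ s1 := by
  constructor
  · rintro ⟨n, rfl⟩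
    exact ⟨_, _, (List.take_append_drop (n % s.length) s).symm,
      List.rotate_eq_drop_append_take_mod⟩
  · rintro ⟨s1, s2, rfl, rfl⟩
    exact List.isRotated_append

/-- The list differs from its proper rotations. -/
def Prim (s : List Tok) : Prop := ∀ s1 s2, s = s1 ++ s2 → s2 ++ s1 = s → s1 = [] ∨ s2 = []

/-- The only marked entry of the first list is its head, so no proper rotation of it starts with a
marked entry. -/
theorem eq_of_isRotated_of_marker (p : Tok → Bool) {a a' : Tok} {v v' : List Tok}
    (ha' : p a' = true) (hv : ∀ x ∈ v, p x = false) (h : (a :: v) ~r (a' :: v')) :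
    a :: v = a' :: v' := by
  obtain ⟨s1, s2, h1, h2⟩ := isRotated_iff_append.1 h
  cases s1 with
  | nil => simp_all
  | cons x s1 =>
    cases s2 with
    | nil => simp_all
    | cons y s2 =>
      simp only [List.cons_append, List.cons.injEq] at h1 h2
      have := hv y (by simp [h1.2])
      rw [← h2.1, ha'] at this
      cases this

theorem prim_of_marker (p : Tok → Bool) {a : Tok} {v : List Tok}
    (ha : p a = true) (hv : ∀ x ∈ v, p x = false) : Prim (a :: v) := by
  intro s1 s2 h1 h2
  cases s1 with
  | nil => simp
  | cons x s1 =>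
    cases s2 with
    | nil => simp
    | cons y s2 =>
      simp only [List.cons_append, List.cons.injEq] at h1 h2
      have := hv y (by simp [h1.2])
      rw [h2.1, ha] at this
      cases this

theorem append_cons_inj_of_marker (p : Tok → Bool) {w w' r r' : List Tok} {a a' : Tok}
    (hw : ∀ x ∈ w, p x = false) (hw' : ∀ x ∈ w', p x = false) (ha : p a = true)
    (ha' : p a' = true) (h : w ++ a :: r = w' ++ a' :: r') : w = w' ∧ a = a' ∧ r = r' := by
  induction w generalizing w' with
  | nil =>
    cases w' with
    | nil => simpa using h
    | cons x w' =>
      obtain rfl : a = x := (List.cons.inj h).1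
      simp [hw' a (by simp)] at ha
  | cons y w ih =>
    cases w' with
    | nil =>
      obtain rfl : y = a' := (List.cons.inj h).1
      simp [hw y (by simp)] at ha'
    | cons x w' =>
      simp only [List.cons_append, List.cons.injEq] at h
      have := ih (w' := w') (fun z hz => hw z (by simp [hz])) (fun z hz => hw' z (by simp [hz])) h.2
      simp_all

theorem append_cons_inj_of_last_marker (p : Tok → Bool) {w w' r r' : List Tok} {a a' : Tok}
    (hr : ∀ x ∈ r, p x = false) (hr' : ∀ x ∈ r', p x = false) (ha : p a = true)
    (ha' : p a' = true) (h : w ++ a :: r = w' ++ a' :: r') : w = w' ∧ a = a' ∧ r = r' := by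
  have h' := congrArg List.reverse h
  simp only [List.reverse_append, List.reverse_cons, List.append_assoc, List.cons_append,
    List.nil_append] at h'
  have := append_cons_inj_of_marker p (by simpa using hr) (by simpa using hr') ha ha' h'
  simp_all

/-- The number of unmatched `β⁻(0)` before the last excursion with label `1`. -/
def before : List Tok → ℕ
  | [] => 0
  | t :: v => if v.any isX then (if t.isA then 1 else 0) + before v else 0

/-- The last excursion with label `1`. -/
def lastX (v : List Tok) : Option Tok := (v.filter isX).getLast?

theorem before_append (x : List Tok) (l : List Neut) (r : List Tok) :
    before (x ++ X l :: r) = x.countP isA + before r := by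
  induction x with
  | nil =>
    by_cases h : r.any isX
    · simp [before, h, isA]
    · cases r with
      | nil => simp [before]
      | cons y r =>
        have h1 : ¬ r.any isX = true := by simp_all
        rw [List.nil_append, before, if_neg h, before, if_neg h1]
        rfl
  | cons y x ih =>
    have : (x ++ X l :: r).any isX = true := by simp [isX]
    rw [List.cons_append, before, if_pos this, ih, List.countP_cons]
    omega

theorem before_eq_zero {r : List Tok} (h : ∀ x ∈ r, x.isX = false) : before r = 0 := by
  cases r with
  | nil => rfl
  | cons y r =>
    have : ¬ r.any isX = true := by simp_all
    rw [before, if_neg this]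

theorem Neutral.before_eq_zero {r : List Tok} (h : Neutral r) : before r = 0 := by
  induction r with
  | nil => rfl
  | cons y r ih =>
    have h1 := ih fun t ht => h t (by simp [ht])
    have h2 := (h y (by simp)).1
    simp [before, h1, h2]

theorem lastX_append {x : List Tok} {l : List Neut} {r : List Tok}
    (h : ∀ x ∈ r, x.isX = false) : lastX (x ++ X l :: r) = some (X l) := by
  have : r.filter isX = [] := by simpa using h
  rw [lastX, List.filter_append, List.filter_cons_of_pos rfl, this, List.getLast?_concat]

theorem Neutral.countP_isA {r : List Tok} (h : Neutral r) : r.countP isA = 0 := by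
  simp only [List.countP_eq_zero]
  intro t ht
  simp [(h t ht).1]

theorem Neutral.isA_eq {r : List Tok} (h : Neutral r) : ∀ x ∈ r, x.isA = false :=
  fun x hx => (h x hx).1

theorem Neutral.isY_eq {r : List Tok} (h : Neutral r) : ∀ x ∈ r, x.isY = false :=
  fun x hx => (h x hx).2

/-- Neither excursions with label `1` nor excursions with label `α₋(1)` occur. -/
def Flat (r : List Tok) : Prop := ∀ t ∈ r, t.isX = false ∧ t.isY = false

theorem Flat.isX_eq {r : List Tok} (h : Flat r) : ∀ x ∈ r, x.isX = false :=
  fun x hx => (h x hx).1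

theorem Flat.isY_eq {r : List Tok} (h : Flat r) : ∀ x ∈ r, x.isY = false :=
  fun x hx => (h x hx).2

/-! ### The injection on token lists -/

/-- Images with exactly one token `Y`, which stands first. -/
inductive ImgY : Fin 7 → List Tok → List Tok → Prop
  | apa {W : Neut} {w r : List Tok} (hw : enc w = W.1) (nw : Neutral w) (hr : Flat r) :
      ImgY 0 (A :: P W :: A :: r) (Y [] :: (w ++ X [] :: r))
  | app {W V : Neut} {w v r : List Tok} (hw : enc w = W.1) (hv : enc v = V.1) (nw : Neutral w)
      (nv : Neutral v) (hr : Flat r) :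
      ImgY 1 (A :: P W :: P V :: r) (Y [] :: ((w ++ A :: v) ++ X [] :: r))
  | pp {W V U : Neut} {v u w : List Tok} (hv : enc v = V.1) (hu : enc u = U.1)
      (hW : enc (P V :: P U :: w) = W.1) (nv : Neutral v) (nu : Neutral u) (nw : Neutral w) :
      ImgY 2 [A, P W] (Y [] :: ((v ++ A :: (u ++ [A, A])) ++ X [] :: w))
  | px {W V : Neut} {l : List Neut} {w : List Tok} (hW : enc (P V :: X l :: w) = W.1)
      (nw : Neutral w) : ImgY 3 [A, P W] (Y [V] :: X l :: (w ++ [A]))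
  | xp {W V : Neut} {w : List Tok} (hW : enc (X [] :: P V :: w) = W.1) (nw : Neutral w) :
      ImgY 4 [A, P W] (Y [V] :: (w ++ [A, X []]))
  | x {W : Neut} {l : List Neut} {w : List Tok} (hl : l ≠ []) (hW : enc (X l :: w) = W.1)
      (nw : Neutral w) : ImgY 5 [A, P W] (Y [] :: ((w ++ [A]) ++ [X l]))
  | p {W V U : Neut} {v : List Tok} (hV : enc (P U :: v) = V.1) (hW : enc [P V] = W.1)
      (nv : Neutral v) : ImgY 6 [A, P W] (Y [] :: (v ++ [X [U], A]))

/-- Images with exactly one token `A`, which stands first, and two tokens `Y`. -/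
inductive ImgA : List Tok → List Tok → Prop
  | xx {W : Neut} {l : List Neut} {w : List Tok} (hW : enc (X [] :: X l :: w) = W.1)
      (nw : Neutral w) : ImgA [A, P W] (A :: Y [] :: X [] :: Y l :: w)
  | p {W V : Neut} {l : List Neut} {v : List Tok} (hV : enc (X l :: v) = V.1)
      (hW : enc [P V] = W.1) (nv : Neutral v) : ImgA [A, P W] (A :: X [] :: Y l :: Y [] :: v)

open Classical in
/-- Recovers the kind of an image with one token `Y`. -/
noncomputable def kind : List Tok → Fin 7
  | Y [] :: v =>
    -- Rule 2 is the only one with three `A` before the last `X`. In rules 0 and 1 the last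
    -- excursion is the inserted `X []`, as the rest is flat; in rules 5 and 6 it is `X l` with `l ≠
    -- []`. The count of `A` before it, `0` or `1`, separates each pair.
    if before v = 3 then 2
    else if lastX v = some (X []) then (if before v = 0 then 0 else 1)
    else (if before v = 0 then 6 else 5)
  | v => if v.getLast? = some A then 3 else 4

theorem ImgY.kind_eq {i : Fin 7} {t s : List Tok} (h : ImgY i t s) : kind s = i := by
  cases h with
  | apa hw nw hr =>
    simp [kind, before_append, lastX_append hr.isX_eq, before_eq_zero hr.isX_eq, nw.countP_isA]
  | app hw hv nw nv hr =>
    simp only [kind, before_append, lastX_append hr.isX_eq, before_eq_zero hr.isX_eq]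
    simp [List.countP_cons, nw.countP_isA, nv.countP_isA, isA]
  | pp hv hu hW nv nu nw =>
    simp only [kind, before_append, nw.before_eq_zero]
    simp [List.countP_cons, nu.countP_isA, nv.countP_isA, isA]
  | px hW nw =>
    rw [kind]
    · rw [← List.cons_append, ← List.cons_append, List.getLast?_concat]
      simp
    · simp
  | @xp W V w hW nw =>
    rw [kind]
    · rw [show Y [V] :: (w ++ [A, X []]) = (Y [V] :: w ++ [A]) ++ [X []] by simp,
        List.getLast?_concat]
      simp
    · simp
  | x hl hW nw =>
    rw [kind, lastX_append (r := []) (by simp), before_append]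
    simp [nw.countP_isA, isA, before, hl]
  | p hV hW nv =>
    rw [kind, lastX_append (r := [A]) (by simp [isX]), before_append]
    simp [nv.countP_isA, before]

theorem ImgY.marker {i : Fin 7} {t s : List Tok} (h : ImgY i t s) :
    ∃ l v, s = Y l :: v ∧ ∀ x ∈ v, x.isY = false := by
  cases h with
  | apa hw nw hr =>
    refine ⟨_, _, rfl, ?_⟩
    simp only [List.mem_append, List.mem_cons]
    rintro x (h | rfl | h)
    exacts [nw.isY_eq x h, rfl, hr.isY_eq x h]
  | app hw hv nw nv hr =>
    refine ⟨_, _, rfl, ?_⟩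
    simp only [List.mem_append, List.mem_cons]
    rintro x ((h | rfl | h) | rfl | h)
    exacts [nw.isY_eq x h, rfl, nv.isY_eq x h, rfl, hr.isY_eq x h]
  | pp hv hu hW nv nu nw =>
    refine ⟨_, _, rfl, ?_⟩
    simp only [List.mem_append, List.mem_cons, List.not_mem_nil, or_false]
    rintro x ((h | rfl | h | rfl | rfl) | rfl | h)
    exacts [nv.isY_eq x h, rfl, nu.isY_eq x h, rfl, rfl, rfl, nw.isY_eq x h]
  | px hW nw =>
    refine ⟨_, _, rfl, ?_⟩
    simp only [List.mem_append, List.mem_cons, List.not_mem_nil, or_false]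
    rintro x (rfl | h | rfl)
    exacts [rfl, nw.isY_eq x h, rfl]
  | xp hW nw =>
    refine ⟨_, _, rfl, ?_⟩
    simp only [List.mem_append, List.mem_cons, List.not_mem_nil, or_false]
    rintro x (h | rfl | rfl)
    exacts [nw.isY_eq x h, rfl, rfl]
  | x hl hW nw =>
    refine ⟨_, _, rfl, ?_⟩
    simp only [List.mem_append, List.mem_cons, List.not_mem_nil, or_false]
    rintro x ((h | rfl) | rfl)
    exacts [nw.isY_eq x h, rfl, rfl]
  | p hV hW nv =>
    refine ⟨_, _, rfl, ?_⟩
    simp only [List.mem_append, List.mem_cons, List.not_mem_nil, or_false]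
    rintro x (h | rfl | rfl)
    exacts [nv.isY_eq x h, rfl, rfl]

theorem ImgY.exists_isX {i : Fin 7} {t s : List Tok} (h : ImgY i t s) :
    ∃ x ∈ s, x.isX = true := by
  have : ∀ (l : List Neut) {s : List Tok}, X l ∈ s → ∃ x ∈ s, x.isX = true :=
    fun l _ h => ⟨X l, h, rfl⟩
  cases h with
  | apa | app | pp | xp => exact this [] (by simp)
  | @px _ _ l => exact this l (by simp)
  | @x _ l => exact this l (by simp)
  | @p _ _ U => exact this [U] (by simp)

theorem ImgY.length_eq {i : Fin 7} {t s : List Tok} (h : ImgY i t s) :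
    (enc s).length = (enc t).length := by
  cases h <;> simp_all [Tok.enc] <;> grind

/-- Once `kind` has identified the rule, the inserted `A` and `X` serve as separators: the pieces
between them are neutral or flat, so splitting at the first `A` or the last `X` recovers them. A
neutral piece determines its word by `enc`. -/
theorem ImgY.injective {i j : Fin 7} {t t' s : List Tok} (h : ImgY i t s) (h' : ImgY j t' s) :
    t = t' := by
  obtain rfl : i = j := h.kind_eq.symm.trans h'.kind_eq
  generalize hs : s = s' at h'
  cases h with
  | apa hw nw hr =>
    cases h' with
    | apa hw' nw' hr' =>
      obtain ⟨rfl, -, rfl⟩ := append_cons_inj_of_last_marker isX hr.isX_eq hr'.isX_eq rfl rfl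
        (List.cons.inj hs).2
      rw [Subtype.ext (hw.symm.trans hw')]
  | app hw hv nw nv hr =>
    cases h' with
    | app hw' hv' nw' nv' hr' =>
      obtain ⟨h1, -, rfl⟩ := append_cons_inj_of_last_marker isX hr.isX_eq hr'.isX_eq rfl rfl
        (List.cons.inj hs).2
      obtain ⟨rfl, -, rfl⟩ := append_cons_inj_of_marker isA nw.isA_eq nw'.isA_eq rfl rfl h1
      rw [Subtype.ext (hw.symm.trans hw'), Subtype.ext (hv.symm.trans hv')]
  | pp hv hu hW nv nu nw =>
    cases h' with
    | pp hv' hu' hW' nv' nu' nw' =>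
      simp only [List.cons.injEq, true_and, List.append_assoc, List.cons_append,
        List.nil_append] at hs
      obtain ⟨rfl, -, h1⟩ := append_cons_inj_of_marker isA nv.isA_eq nv'.isA_eq rfl rfl hs
      obtain ⟨rfl, -, h2⟩ := append_cons_inj_of_marker isA nu.isA_eq nu'.isA_eq rfl rfl h1
      simp only [List.cons.injEq, true_and] at h2
      subst h2
      obtain rfl := Subtype.ext (hv.symm.trans hv')
      obtain rfl := Subtype.ext (hu.symm.trans hu')
      rw [Subtype.ext (hW.symm.trans hW')]
  | px hW nw =>
    cases h' with
    | px hW' nw' =>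
      simp only [List.cons.injEq, Y.injEq, X.injEq, and_true, List.append_cancel_right_eq] at hs
      obtain ⟨rfl, rfl, rfl⟩ := hs
      rw [Subtype.ext (hW.symm.trans hW')]
  | xp hW nw =>
    cases h' with
    | xp hW' nw' =>
      simp only [List.cons.injEq, Y.injEq, and_true, List.append_cancel_right_eq] at hs
      obtain ⟨rfl, rfl⟩ := hs
      rw [Subtype.ext (hW.symm.trans hW')]
  | x hl hW nw =>
    cases h' with
    | x hl' hW' nw' =>
      obtain ⟨h1, h2, -⟩ := append_cons_inj_of_last_marker isX (by simp) (by simp) rfl rfl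
        (List.cons.inj hs).2
      simp only [List.append_cancel_right_eq, X.injEq] at h1 h2
      subst h1 h2
      rw [Subtype.ext (hW.symm.trans hW')]
  | p hV hW nv =>
    cases h' with
    | p hV' hW' nv' =>
      obtain ⟨rfl, h2, -⟩ := append_cons_inj_of_last_marker isX (by simp [isX]) (by simp [isX])
        rfl rfl (List.cons.inj hs).2
      simp only [X.injEq, List.cons.injEq, and_true] at h2
      subst h2
      obtain rfl := Subtype.ext (hV.symm.trans hV')
      rw [Subtype.ext (hW.symm.trans hW')]

theorem ImgA.marker {t s : List Tok} (h : ImgA t s) :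
    ∃ v, s = A :: v ∧ ∀ x ∈ v, x.isA = false := by
  cases h with
  | xx hW nw =>
    refine ⟨_, rfl, ?_⟩
    simp only [List.mem_cons]
    rintro x (rfl | rfl | rfl | h)
    exacts [rfl, rfl, rfl, nw.isA_eq x h]
  | p hV hW nv =>
    refine ⟨_, rfl, ?_⟩
    simp only [List.mem_cons]
    rintro x (rfl | rfl | rfl | h)
    exacts [rfl, rfl, rfl, nv.isA_eq x h]

theorem ImgA.countP_isY {t s : List Tok} (h : ImgA t s) : 2 ≤ s.countP isY := by
  cases h <;> simp [isY, List.countP_cons]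

theorem ImgA.exists_isX {t s : List Tok} (h : ImgA t s) : ∃ x ∈ s, x.isX = true := by
  cases h <;> simp [isX]

theorem ImgA.length_eq {t s : List Tok} (h : ImgA t s) : (enc s).length = (enc t).length := by
  cases h <;> simp_all [Tok.enc] <;> grind

theorem ImgA.injective {t t' s : List Tok} (h : ImgA t s) (h' : ImgA t' s) : t = t' := by
  generalize hs : s = s' at h'
  cases h with
  | xx hW nw =>
    cases h' with
    | xx hW' nw' =>
      simp only [List.cons.injEq, Y.injEq, true_and] at hs
      obtain ⟨rfl, rfl⟩ := hs
      rw [Subtype.ext (hW.symm.trans hW')]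
    | p => simp at hs
  | p hV hW nv =>
    cases h' with
    | xx => simp at hs
    | p hV' hW' nv' =>
      simp only [List.cons.injEq, Y.injEq, true_and] at hs
      obtain ⟨rfl, rfl⟩ := hs
      obtain rfl := Subtype.ext (hV.symm.trans hV')
      rw [Subtype.ext (hW'.symm.trans hW).symm]

/-- The relation between a token list without `Y` and its image, which contains `Y`. -/
inductive Img : List Tok → List Tok → Prop
  | toY {t : List Tok} (hX : ∃ x ∈ t, x.isX = true) (hY : ∀ x ∈ t, x.isY = false) :
      Img t (t.map Tok.toY)
  | imgY {i : Fin 7} {t s : List Tok} (h : ImgY i t s) : Img t s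
  | imgA {t s : List Tok} (h : ImgA t s) : Img t s

theorem isX_toY (t : Tok) : t.toY.isX = false := by cases t <;> rfl

theorem toX_toY {t : Tok} (h : t.isY = false) : t.toY.toX = t := by
  cases t <;> simp_all [Tok.toY, Tok.toX, isY]

theorem map_toX_map_toY {t : List Tok} (h : ∀ x ∈ t, x.isY = false) :
    (t.map Tok.toY).map Tok.toX = t := by
  rw [List.map_map]
  exact (List.map_congr_left fun x hx => toX_toY (h x hx)).trans (List.map_id' t)

theorem length_enc_map_toY (t : List Tok) : (enc (t.map Tok.toY)).length = (enc t).length := by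
  induction t with
  | nil => rfl
  | cons x t ih => cases x <;> simp [Tok.toY, Tok.enc, ih]

theorem Img.length_eq {t s : List Tok} (h : Img t s) : (enc s).length = (enc t).length := by
  cases h with
  | toY hX hY => exact length_enc_map_toY t
  | imgY h => exact h.length_eq
  | imgA h => exact h.length_eq

theorem Img.exists_isY {t s : List Tok} (h : Img t s) : ∃ x ∈ s, x.isY = true := by
  cases h with
  | toY hX hY =>
    obtain ⟨x, hx, h⟩ := hX
    refine ⟨x.toY, List.mem_map_of_mem hx, ?_⟩
    cases x <;> simp_all [isX, isY, Tok.toY]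
  | imgY h =>
    obtain ⟨l, v, rfl, -⟩ := h.marker
    simp [isY]
  | imgA h =>
    have := h.countP_isY
    exact List.countP_pos_iff.1 (by omega)

/-- The three families of images cannot meet: `toY` leaves no `X` whereas the other images have one,
and those from `ImgY` have one `Y` against at least two from `ImgA`. In the last two families the
unique leading marker turns equality up to rotation into equality. -/
theorem Img.injective {t t' s s' : List Tok} (h : Img t s) (h' : Img t' s') (hs : s ~r s') :
    t ~r t' := by
  have noX : ∀ {a b c : List Tok}, a.map Tok.toY = b → b ~r c → ∀ x ∈ c, x.isX = false := by
    rintro a _ c rfl hc x hx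
    obtain ⟨y, -, rfl⟩ := List.mem_map.1 (hc.mem_iff.2 hx)
    exact isX_toY y
  have one : ∀ {i a b c d}, ImgY i a b → ImgA c d → b ~r d → False := by
    intro i a b c d h1 h2 h3
    obtain ⟨l, v, rfl, hv⟩ := h1.marker
    have := h2.countP_isY
    rw [← h3.perm.countP_eq] at this
    have hz : v.countP isY = 0 := by
      simp only [List.countP_eq_zero]
      intro x hx
      simp [hv x hx]
    rw [List.countP_cons, hz] at this
    simp [isY] at this
  cases h with
  | toY hX hY =>
    cases h' with
    | toY hX' hY' =>
      have := hs.map Tok.toX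
      rwa [map_toX_map_toY hY, map_toX_map_toY hY'] at this
    | imgY h' =>
      obtain ⟨x, hx, h1⟩ := h'.exists_isX
      exact absurd h1 (by simp [noX rfl hs x hx])
    | imgA h' =>
      obtain ⟨x, hx, h1⟩ := h'.exists_isX
      exact absurd h1 (by simp [noX rfl hs x hx])
  | imgY h =>
    cases h' with
    | toY hX' hY' =>
      obtain ⟨x, hx, h1⟩ := h.exists_isX
      exact absurd h1 (by simp [noX rfl hs.symm x hx])
    | imgY h' =>
      obtain ⟨l, v, rfl, hv⟩ := h.marker
      obtain ⟨l', v', rfl, hv'⟩ := h'.marker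
      rw [← eq_of_isRotated_of_marker isY rfl hv hs] at h'
      rw [h.injective h']
    | imgA h' => exact (one h h' hs).elim
  | imgA h =>
    cases h' with
    | toY hX' hY' =>
      obtain ⟨x, hx, h1⟩ := h.exists_isX
      exact absurd h1 (by simp [noX rfl hs.symm x hx])
    | imgY h' => exact (one h' h hs.symm).elim
    | imgA h' =>
      obtain ⟨v, rfl, hv⟩ := h.marker
      obtain ⟨v', rfl, hv'⟩ := h'.marker
      rw [← eq_of_isRotated_of_marker isA rfl hv hs] at h'
      rw [h.injective h']

theorem Prim.map_toY {t : List Tok} (h : Prim t) (hY : ∀ x ∈ t, x.isY = false) :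
    Prim (t.map Tok.toY) := by
  intro s1 s2 h1 h2
  obtain ⟨t1, t2, rfl, rfl, rfl⟩ := List.map_eq_append_iff.1 h1
  have h3 := congrArg (List.map Tok.toX) h2
  rw [← List.map_append, map_toX_map_toY hY,
    map_toX_map_toY (fun x hx => hY x (by simp at hx ⊢; tauto))] at h3
  rcases h t1 t2 rfl h3 with rfl | rfl <;> simp

/-- Token lists that describe the periodic orbits of length `n` with negative multiplier. -/
structure Good (n : ℕ) (s : List Tok) : Prop where
  length_eq : (enc s).length = n
  exists_val : ∃ x ∈ s, x.isA = true ∨ x.isY = true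
  prim : Prim s

/-! ### Existence of images -/

/-- Going round the cycle up to a token other than `A`, the last `A` met before returning to it is
followed by a token that is not `A`. -/
theorem exists_rotate_A_P {t : List Tok} (hA : ∃ x ∈ t, x.isA = true)
    (hP : ∃ x ∈ t, x.isA = false) : ∃ y r, t ~r (A :: y :: r) ∧ y.isA = false := by
  obtain ⟨x, hx, hxA⟩ := hA
  obtain ⟨y, hy, hyA⟩ := hP
  obtain ⟨t1, t2, rfl⟩ := List.append_of_mem hy
  have key : ∀ r : List Tok, (∃ x ∈ r, x.isA = true) →
      ∃ r1 r2, r = r1 ++ A :: r2 ∧ ∀ x ∈ r2, x.isA = false := by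
    intro r
    induction r with
    | nil => simp
    | cons z r ih =>
      intro h
      by_cases hr : ∃ x ∈ r, x.isA = true
      · obtain ⟨r1, r2, rfl, h2⟩ := ih hr
        exact ⟨z :: r1, r2, rfl, h2⟩
      · have hz : z = A := by
          obtain ⟨x, hx, hxA⟩ := h
          rcases List.mem_cons.1 hx with rfl | hx
          · cases x <;> simp_all [isA]
          · exact absurd ⟨x, hx, hxA⟩ hr
        exact ⟨[], r, by simp [hz], by simpa using hr⟩
  obtain ⟨r1, r2, h1, h2⟩ := key (t2 ++ t1) ⟨x, by
    have : x ≠ y := by rintro rfl; simp_all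
    simp at hx ⊢; tauto, hxA⟩
  have h3 : (t1 ++ y :: t2) ~r (A :: (r2 ++ y :: r1)) := by
    have e1 : (t1 ++ y :: t2) ~r ((y :: t2) ++ t1) := List.isRotated_append
    rw [List.cons_append, h1, ← List.cons_append] at e1
    have e2 := e1.trans (List.isRotated_append (l := y :: r1) (l' := A :: r2))
    simpa using e2
  cases r2 with
  | nil => exact ⟨y, r1, h3, hyA⟩
  | cons z r2 => exact ⟨z, _, h3, h2 z (by simp)⟩

/-- The cases without a rule are `W` empty and `W` encoding `[P w]` with `w` empty or `[X []]`;
these have length `0` and `2`. -/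
theorem exists_img_single {W : Neut} (h0 : W.1.length ≠ 0) (h2 : W.1.length ≠ 2) :
    ∃ s, Img [A, P W] s := by
  obtain ⟨s, hs, ns⟩ := exists_enc_neut W
  have tail : ∀ {x s}, Neutral (x :: s) → Neutral s := fun h t ht => h t (by simp [ht])
  cases s with
  | nil => simp [← hs] at h0
  | cons x s =>
    cases x with
    | A => simpa [isA] using ns A (by simp)
    | Y l => simpa [isY] using ns (Y l) (by simp)
    | P V =>
      obtain ⟨v, hv, nv⟩ := exists_enc_neut V
      cases s with
      | nil =>
        cases v with
        | nil => simp [← hs, Tok.enc, ← hv] at h2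
        | cons y v =>
          cases y with
          | A => simpa [isA] using nv A (by simp)
          | Y l => simpa [isY] using nv (Y l) (by simp)
          | P U => exact ⟨_, .imgY (.p hv hs (tail nv))⟩
          | X l => exact ⟨_, .imgA (.p hv hs (tail nv))⟩
      | cons y s =>
        cases y with
        | A => simpa [isA] using ns A (by simp)
        | Y l => simpa [isY] using ns (Y l) (by simp)
        | P U =>
          obtain ⟨u, hu, nu⟩ := exists_enc_neut U
          exact ⟨_, .imgY (.pp hv hu hs nv nu (tail (tail ns)))⟩
        | X l => exact ⟨_, .imgY (.px hs (tail (tail ns)))⟩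
    | X l =>
      cases l with
      | cons V l => exact ⟨_, .imgY (.x (by simp) hs (tail ns))⟩
      | nil =>
        cases s with
        | nil => simp [← hs, Tok.enc] at h2
        | cons y s =>
          cases y with
          | A => simpa [isA] using ns A (by simp)
          | Y l => simpa [isY] using ns (Y l) (by simp)
          | P V => exact ⟨_, .imgY (.xp hs (tail (tail ns)))⟩
          | X l => exact ⟨_, .imgA (.xx hs (tail (tail ns)))⟩

theorem exists_img {n : ℕ} (h1 : n ≠ 1) (h3 : n ≠ 3) (h5 : n ≠ 5) {t : List Tok} (ht : Good n t)
    (hY : ∀ x ∈ t, x.isY = false) : ∃ t' s, t ~r t' ∧ Img t' s ∧ Good n s := by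
  by_cases hX : ∃ x ∈ t, x.isX = true
  · have hi := Img.toY hX hY
    refine ⟨t, _, List.IsRotated.refl t, hi, hi.length_eq.trans ht.length_eq, ?_,
      ht.prim.map_toY hY⟩
    obtain ⟨x, hx, h⟩ := hi.exists_isY
    exact ⟨x, hx, .inr h⟩
  · have hF : Flat t := fun x hx => ⟨by
      by_contra h
      exact hX ⟨x, hx, by simpa using h⟩, hY x hx⟩
    have hA : ∃ x ∈ t, x.isA = true := by
      obtain ⟨x, hx, h | h⟩ := ht.exists_val
      · exact ⟨x, hx, h⟩
      · simp [hY x hx] at h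
    have hP : ∃ x ∈ t, x.isA = false := by
      by_contra! h
      have hr : t = List.replicate t.length A := List.eq_replicate_iff.2 ⟨rfl, fun x hx => by
        have := h x hx
        cases x <;> simp_all [isA]⟩
      obtain ⟨k, hk⟩ : ∃ k, t.length = k + 1 := by
        obtain ⟨x, hx, -⟩ := hA
        exact Nat.exists_eq_succ_of_ne_zero (List.length_pos_of_mem hx).ne'
      rw [hk] at hr
      -- A list of `A` alone is fixed by rotation by one token, so primitivity leaves only `[A]`, of
      -- length `1`.
      have := ht.prim [A] (List.replicate k A) (by rw [hr]; rfl)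
        (by rw [hr, List.replicate_succ'])
      obtain rfl : k = 0 := by simpa using this
      have := ht.length_eq
      rw [hr] at this
      simp [Tok.enc] at this
      omega
    obtain ⟨y, r, hrot, hy⟩ := exists_rotate_A_P hA hP
    have hF' : Flat (A :: y :: r) := fun x hx => hF x (hrot.mem_iff.2 hx)
    have hlen : (enc (A :: y :: r)).length = n := by
      rw [← ht.length_eq]
      exact ((hrot.perm.flatMap_right Tok.enc).length_eq).symm
    obtain ⟨s, hs⟩ : ∃ s, Img (A :: y :: r) s := by
      cases y with
      | A => simp [isA] at hy
      | X l => simpa [isX] using (hF' (X l) (by simp)).1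
      | Y l => simpa [isY] using (hF' (Y l) (by simp)).2
      | P W =>
        cases r with
        | nil =>
          apply exists_img_single
          all_goals
            simp [Tok.enc] at hlen
            omega
        | cons z r =>
          obtain ⟨w, hw, nw⟩ := exists_enc_neut W
          have hr : Flat r := fun x hx => hF' x (by simp [hx])
          cases z with
          | A => exact ⟨_, .imgY (.apa hw nw hr)⟩
          | X l => simpa [isX] using (hF' (X l) (by simp)).1
          | Y l => simpa [isY] using (hF' (Y l) (by simp)).2
          | P V =>
            obtain ⟨v, hv, nv⟩ := exists_enc_neut V
            exact ⟨_, .imgY (.app hw hv nw nv hr)⟩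
    refine ⟨_, s, hrot, hs, hs.length_eq.trans hlen, ?_, ?_⟩
    · obtain ⟨x, hx, h⟩ := hs.exists_isY
      exact ⟨x, hx, .inr h⟩
    · cases hs with
      | toY hX' _ =>
        obtain ⟨x, hx, h⟩ := hX'
        simp [(hF' x hx).1] at h
      | imgY h =>
        obtain ⟨l, v, rfl, hv⟩ := h.marker
        exact prim_of_marker isY rfl hv
      | imgA h =>
        obtain ⟨v, rfl, hv⟩ := h.marker
        exact prim_of_marker isA rfl hv

/-! ### The action of the Dyck inverse monoid on stacks -/

instance (N : ℕ) : MonoidWithZero (DyckMonoid N) where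
  zero_mul x := by
    obtain ⟨y, rfl⟩ : ∃ y, DyckMonoid.mk N y = x := Con.mk'_surjective x
    exact ((DyckMonoid.mk N).map_mul 0 y).symm.trans (by rw [zero_mul]; rfl)
  mul_zero x := by
    obtain ⟨y, rfl⟩ : ∃ y, DyckMonoid.mk N y = x := Con.mk'_surjective x
    exact ((DyckMonoid.mk N).map_mul y 0).symm.trans (by rw [mul_zero]; rfl)

theorem alphaNeg_mul_alphaPos_self {N : ℕ} (n : Fin N) : alphaNeg n * alphaPos n = 1 :=
  (Con.eq (conGen (DyckRel N))).2 (ConGen.Rel.of _ _ (DyckRel.cancel n))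

theorem alphaNeg_mul_alphaPos_of_ne {N : ℕ} {n m : Fin N} (h : n ≠ m) :
    alphaNeg n * alphaPos m = 0 :=
  (Con.eq (conGen (DyckRel N))).2 (ConGen.Rel.of _ _ (DyckRel.vanish n m h))

/-- The homomorphism from the Dyck inverse monoid given by images of the generators that satisfy
the defining relations. -/
def DyckMonoid.lift {N : ℕ} {M : Type*} [MonoidWithZero M] (f : DyckGen N → M)
    (h1 : ∀ n, f (.neg n) * f (.pos n) = 1) (h0 : ∀ n m, n ≠ m → f (.neg n) * f (.pos m) = 0) :
    DyckMonoid N →* M :=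
  Con.lift (conGen (DyckRel N)) (WithZero.lift' (FreeMonoid.lift f) :
    WithZero (FreeMonoid (DyckGen N)) →*₀ M).toMonoidHom (Con.conGen_le.2 (by
      intro x y h
      cases h with
      | cancel n =>
        rw [Con.ker_rel]
        simpa using h1 n
      | vanish n m h =>
        rw [Con.ker_rel]
        simpa using h0 n m h))

section lift

variable {N : ℕ} {M : Type*} [MonoidWithZero M] (f : DyckGen N → M)
    (h1 : ∀ n, f (.neg n) * f (.pos n) = 1) (h0 : ∀ n m, n ≠ m → f (.neg n) * f (.pos m) = 0)

theorem DyckMonoid.lift_alphaNeg (n : Fin N) :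
    DyckMonoid.lift f h1 h0 (alphaNeg n) = f (.neg n) := by
  change (WithZero.lift' (FreeMonoid.lift f))
    ((FreeMonoid.of (DyckGen.neg n) : FreeMonoid (DyckGen N)) :
      WithZero (FreeMonoid (DyckGen N))) = _
  simp

theorem DyckMonoid.lift_alphaPos (n : Fin N) :
    DyckMonoid.lift f h1 h0 (alphaPos n) = f (.pos n) := by
  change (WithZero.lift' (FreeMonoid.lift f))
    ((FreeMonoid.of (DyckGen.pos n) : FreeMonoid (DyckGen N)) :
      WithZero (FreeMonoid (DyckGen N))) = _
  simp

theorem DyckMonoid.lift_zero : DyckMonoid.lift f h1 h0 0 = 0 := by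
  change (WithZero.lift' (FreeMonoid.lift f)) 0 = _
  simp

end lift

/-- Partial maps on stacks, composed from left to right. -/
@[ext] structure StackMap (N : ℕ) : Type where
  /-- The underlying partial map. -/
  app : List (Fin N) → Option (List (Fin N))

instance (N : ℕ) : MonoidWithZero (StackMap N) where
  one := ⟨fun s => some s⟩
  zero := ⟨fun _ => none⟩
  mul f g := ⟨fun s => (f.app s).bind g.app⟩
  mul_assoc f g h := StackMap.ext (funext fun s => Option.bind_assoc (f.app s) g.app h.app)
  one_mul _ := rfl
  mul_one f := StackMap.ext (funext fun s => Option.bind_fun_some (f.app s))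
  zero_mul _ := rfl
  mul_zero f := StackMap.ext (funext fun s => Option.bind_fun_none (f.app s))

theorem StackMap.mul_app {N : ℕ} (f g : StackMap N) (s : List (Fin N)) :
    (f * g).app s = (f.app s).bind g.app := rfl

/-- The partial maps of the generators: `α₋(n)` pushes, `α₊(n)` pops. -/
def stackGen (N : ℕ) : DyckGen N → StackMap N
  | .neg n => ⟨fun s => some (n :: s)⟩
  | .pos n => ⟨fun s => if s.head? = some n then some s.tail else none⟩

/-- The action of the Dyck inverse monoid on stacks. -/
def stackHom (N : ℕ) : DyckMonoid N →* StackMap N :=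
  DyckMonoid.lift (stackGen N)
    (fun n => StackMap.ext (funext fun s => by simp [StackMap.mul_app, stackGen]; rfl))
    (fun n m h => StackMap.ext (funext fun s => by simp [StackMap.mul_app, stackGen, h]; rfl))

theorem stackHom_alphaNeg {N : ℕ} (n : Fin N) (s : List (Fin N)) :
    (stackHom N (alphaNeg n)).app s = some (n :: s) := by
  rw [stackHom, DyckMonoid.lift_alphaNeg]; rfl

theorem stackHom_alphaPos {N : ℕ} (n : Fin N) (s : List (Fin N)) :
    (stackHom N (alphaPos n)).app s = if s.head? = some n then some s.tail else none := by
  rw [stackHom, DyckMonoid.lift_alphaPos]; rfl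

theorem stackHom_zero {N : ℕ} (s : List (Fin N)) : (stackHom N 0).app s = none := by
  rw [stackHom, DyckMonoid.lift_zero]; rfl

theorem stackHom_one {N : ℕ} (s : List (Fin N)) : (stackHom N 1).app s = some s := by
  rw [map_one]; rfl

theorem stackHom_mul {N : ℕ} (x y : DyckMonoid N) (s : List (Fin N)) :
    (stackHom N (x * y)).app s = ((stackHom N x).app s).bind (stackHom N y).app := by
  rw [map_mul]; rfl

@[simp] theorem negProd_nil {N : ℕ} : negProd ([] : List (Fin N)) = 1 := rfl

theorem negProd_append {N : ℕ} (u v : List (Fin N)) :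
    negProd (u ++ v) = negProd u * negProd v := by simp [negProd]

theorem negProd_singleton {N : ℕ} (n : Fin N) : negProd [n] = alphaNeg n := by simp [negProd]

theorem negProd_cons {N : ℕ} (n : Fin N) (v : List (Fin N)) :
    negProd (n :: v) = alphaNeg n * negProd v := by simp [negProd]

theorem negProd_flatten_replicate {N : ℕ} (w : List (Fin N)) (k : ℕ) :
    negProd (List.replicate k w).flatten = negProd w ^ k := by
  induction k with
  | zero => simp
  | succ k ih => rw [List.replicate_succ, List.flatten_cons, negProd_append, ih, pow_succ']

theorem stackHom_negProd {N : ℕ} (w s : List (Fin N)) :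
    (stackHom N (negProd w)).app s = some (w.reverse ++ s) := by
  induction w generalizing s with
  | nil => exact stackHom_one s
  | cons n w ih =>
    rw [negProd_cons, stackHom_mul, stackHom_alphaNeg, Option.bind_some, ih]
    simp

theorem negProd_ne_zero {N : ℕ} (w : List (Fin N)) : negProd w ≠ 0 := by
  intro h
  have := stackHom_negProd w []
  rw [h, stackHom_zero] at this
  cases this

theorem mem_negPart_iff {N : ℕ} {x : DyckMonoid N} :
    x ∈ negPart N ↔ ∃ w, w ≠ [] ∧ x = negProd w := by
  constructor
  · intro h
    induction h using Subsemigroup.closure_induction with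
    | mem x hx =>
      obtain ⟨n, rfl⟩ := hx
      exact ⟨[n], by simp, (negProd_singleton n).symm⟩
    | mul x y _ _ hx hy =>
      obtain ⟨u, hu, rfl⟩ := hx
      obtain ⟨v, hv, rfl⟩ := hy
      exact ⟨u ++ v, by simp [hu], (negProd_append u v).symm⟩
  · rintro ⟨w, hw, rfl⟩
    induction w with
    | nil => exact absurd rfl hw
    | cons n w ih =>
      have hn : alphaNeg n ∈ negPart N := Subsemigroup.subset_closure ⟨n, rfl⟩
      rcases eq_or_ne w [] with rfl | hne
      · rwa [negProd_singleton]
      · rw [negProd_cons]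
        exact mul_mem hn (ih hne)

/-! ### Labels and the stack machine -/

theorem step_eq (e : FibEdge) (v : Fin 2) (s : List (Fin 2)) :
    step e (v, s) = if fibDyck.source e = v then
      ((stackHom 2 (fibDyck.label e)).app s).map fun s' => (fibDyck.target e, s') else none := by
  cases e <;> simp only [step, fibDyck, stackHom_alphaNeg, stackHom_alphaPos, stackHom_one,
    Option.map_some, eq_comm (b := v)]
  all_goals by_cases h : s.head? = some 0 <;> by_cases h' : s.head? = some 1 <;> simp [h, h']

/-- This carries information from the monoid to the stack machine: since the monoid acts on stacks,
an equality of labels fixes the outcome of a run. The converse passage is `labelWord_of_run`. -/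
theorem run_of_isPath {b : List FibEdge} (hb : fibDyck.IsPath b) {v : Fin 2}
    {s s' : List (Fin 2)} (hv : ∀ e ∈ b.head?, fibDyck.source e = v)
    (h : (stackHom 2 (fibDyck.labelWord b)).app s = some s') :
    ∃ v', run b (v, s) = some (v', s') ∧ ∀ e ∈ b.getLast?, fibDyck.target e = v' := by
  induction b generalizing v s with
  | nil =>
    rw [show fibDyck.labelWord [] = 1 from rfl, stackHom_one] at h
    exact ⟨v, by simpa using h, by simp⟩
  | cons e b ih =>
    rw [show fibDyck.labelWord (e :: b) = fibDyck.label e * fibDyck.labelWord b by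
      simp [LabelledGraph.labelWord], stackHom_mul] at h
    obtain ⟨s1, h1, h2⟩ := Option.bind_eq_some_iff.1 h
    have hs : step e (v, s) = some (fibDyck.target e, s1) := by
      rw [step_eq, if_pos (hv e (by simp)), h1, Option.map_some]
    have hc := List.isChain_cons.1 hb
    obtain ⟨v', h3, h4⟩ := ih hc.2 (v := fibDyck.target e)
      (fun e' he' => (hc.1 e' he').symm) h2
    refine ⟨v', by simp [hs, h3], ?_⟩
    cases b with
    | nil =>
      simp only [run_nil, Option.some.injEq, Prod.mk.injEq] at h3
      simpa using h3.1
    | cons e' b => simpa [List.getLast?_cons_cons] using h4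

theorem isPath_of_run {b : List FibEdge} {q q' : State} (h : run b q = some q') :
    fibDyck.IsPath b := by
  induction b generalizing q with
  | nil => exact List.isChain_nil
  | cons e b ih =>
    obtain ⟨⟨v, s⟩, h1, h2⟩ := Option.bind_eq_some_iff.1 h
    refine List.isChain_cons.2 ⟨?_, ih h2⟩
    intro e' he'
    cases b with
    | nil => simp at he'
    | cons x b =>
      obtain rfl : x = e' := by simpa using he'
      obtain ⟨_, h3, _⟩ := Option.bind_eq_some_iff.1 h2
      exact (step_target h1).trans (step_source h3).symm

/-- A stack, listed from its top, stands for the product of `α₋`'s read from its bottom, hence the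
`reverse`. A pop is the relation `α₋(a) α₊(a) = 1` at the right end of that product. -/
theorem negProd_mul_label_of_step {e : FibEdge} {v v' : Fin 2} {s s' : List (Fin 2)}
    (h : step e (v, s) = some (v', s')) :
    negProd s.reverse * fibDyck.label e = negProd s'.reverse := by
  have hpop : ∀ a t, negProd (List.reverse (a :: t)) * alphaPos a = negProd (N := 2) t.reverse := by
    intro a t
    rw [List.reverse_cons, negProd_append, negProd_singleton, mul_assoc,
      alphaNeg_mul_alphaPos_self, mul_one]
  cases e <;> simp only [step, Option.ite_none_right_eq_some, Option.some.injEq,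
    Prod.mk.injEq] at h <;> obtain ⟨h1, rfl, rfl⟩ := h
  case neg0 => simp [fibDyck, negProd_append, negProd_singleton]
  case neg => simp [fibDyck]
  case neg1 => simp [fibDyck, negProd_append, negProd_singleton]
  case pos0 =>
    obtain ⟨t, rfl⟩ := List.head?_eq_some_iff.1 h1.2
    exact hpop 0 t
  case pos => simp [fibDyck]
  case pos1 =>
    obtain ⟨t, rfl⟩ := List.head?_eq_some_iff.1 h1.2
    exact hpop 1 t

theorem negProd_mul_labelWord_of_run {b : List FibEdge} {v v' : Fin 2} {s s' : List (Fin 2)}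
    (h : run b (v, s) = some (v', s')) :
    negProd s.reverse * fibDyck.labelWord b = negProd s'.reverse := by
  induction b generalizing v s with
  | nil =>
    obtain ⟨-, rfl⟩ : v = v' ∧ s = s' := by simpa using h
    simp [LabelledGraph.labelWord]
  | cons e b ih =>
    obtain ⟨⟨v1, s1⟩, h1, h2⟩ := Option.bind_eq_some_iff.1 h
    rw [← ih h2, ← negProd_mul_label_of_step h1, mul_assoc]
    simp [LabelledGraph.labelWord]

theorem labelWord_of_run {b : List FibEdge} {v v' : Fin 2} {s' : List (Fin 2)}
    (h : run b (v, []) = some (v', s')) : fibDyck.labelWord b = negProd s'.reverse := by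
  simpa using negProd_mul_labelWord_of_run h

/-- The position of the first unmatched negative edge. -/
theorem exists_unmatched {b : List FibEdge} {v v' : Fin 2} {u : List (Fin 2)} {a : Fin 2}
    (h : run b (v, []) = some (v', u ++ [a])) :
    ∃ b1 e b2 v1, b = b1 ++ e :: b2 ∧ run b1 (v, []) = some (v1, []) ∧
      step e (v1, []) = some (0, [a]) ∧ run b2 (0, []) = some (v', u) := by
  induction hn : b.length using Nat.strong_induction_on generalizing b v with
  | _ n ih =>
  cases b with
  | nil => simp at h
  | cons e b =>
    obtain ⟨⟨v1, s1⟩, h1, h2⟩ := Option.bind_eq_some_iff.1 h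
    have hcases : s1 = [] ∨ ∃ c, s1 = [c] ∧ v1 = 0 := by
      cases e <;> simp [step] at h1 <;> grind
    rcases hcases with rfl | ⟨c, rfl, rfl⟩
    · obtain ⟨b1, e', b2, v2, rfl, h4, h5, h6⟩ := ih _ (by simp at hn; omega) h2 rfl
      exact ⟨e :: b1, e', b2, v2, rfl, by simp [h1, h4], h5, h6⟩
    · rcases run_under (s := []) h2 with ⟨u', h3, h4⟩ | ⟨b1, e', b2, v2, v3, rfl, h4, h5, h6⟩
      · obtain ⟨rfl, h5⟩ := List.append_inj' h4 rfl
        obtain rfl : a = c := by simpa using h5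
        exact ⟨[], e, b, v, rfl, rfl, h1, h3⟩
      · obtain ⟨b3, e'', b4, v4, rfl, h7, h8, h9⟩ := ih _ (by simp at hn; omega) h6 rfl
        refine ⟨e :: (b1 ++ e' :: b3), e'', b4, v4, by simp, ?_, h8, h9⟩
        simp [h1, run_append, run_stack_nil h4, h5, h7]

/-! ### Periodic sequences -/

theorem shift_iterate {E : Type} (k : ℕ) (p : ℤ → E) : shift^[k] p = fun i => p (i + k) := by
  induction k generalizing p with
  | zero => simp
  | succ k ih =>
    rw [Function.iterate_succ_apply, ih]
    funext i
    simp only [shift]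
    congr 1
    push_cast
    ring

theorem isPeriodicPt_shift_iff {E : Type} {n : ℕ} {p : ℤ → E} :
    Function.IsPeriodicPt shift n p ↔ ∀ i, p (i + n) = p i := by
  rw [Function.IsPeriodicPt, Function.IsFixedPt, shift_iterate, funext_iff]

section block

variable {E : Type} {p : ℤ → E}

theorem block_eq (p : ℤ → E) (i : ℤ) (n : ℕ) :
    block p i n = (List.range n).map fun k : ℕ => p (i + k) := by
  simp only [block, List.bind_eq_flatMap, List.pure_def, List.map_flatMap, List.map_cons,
    List.map_nil]
  exact (List.map_eq_flatMap ..).symm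

@[simp] theorem length_block (p : ℤ → E) (i : ℤ) (n : ℕ) : (block p i n).length = n := by
  simp [block_eq]

theorem block_add (p : ℤ → E) (i : ℤ) (m n : ℕ) :
    block p i (m + n) = block p i m ++ block p (i + m) n := by
  simp only [block_eq, List.range_add, List.map_append, List.map_map]
  congr 1
  refine List.map_congr_left fun k _ => ?_
  simp only [Function.comp]
  congr 1
  push_cast
  ring

theorem block_succ (p : ℤ → E) (i : ℤ) (n : ℕ) :
    block p i (n + 1) = p i :: block p (i + 1) n := by
  rw [add_comm, block_add]
  simp [block_eq]

theorem periodic_mul {n : ℕ} (h : ∀ i, p (i + n) = p i) (i k : ℤ) : p (i + k * n) = p i := by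
  have h' : Function.Periodic p (n : ℤ) := h
  simpa using h'.int_mul k i

theorem block_periodic {n : ℕ} (h : ∀ i, p (i + n) = p i) (i k : ℤ) (m : ℕ) :
    block p (i + k * n) m = block p i m := by
  rw [block_eq, block_eq]
  refine List.map_congr_left fun j _ => ?_
  rw [add_right_comm, periodic_mul h]

theorem block_rotate {n : ℕ} (h : ∀ i, p (i + n) = p i) (i : ℤ) {a b : List E}
    (hab : block p i n = a ++ b) : block p (i + a.length) n = b ++ a := by
  have hn : n = a.length + b.length := by simpa using congrArg List.length hab
  have h1 := block_add p i a.length b.length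
  have h2 := block_add p (i + a.length) b.length a.length
  rw [add_comm b.length, add_assoc i, ← Nat.cast_add, ← hn] at h2
  rw [← hn, hab] at h1
  obtain ⟨e1, e2⟩ := List.append_inj h1 (by simp)
  have := block_periodic h i 1 a.length
  rw [one_mul] at this
  rw [h2, this, ← e1, ← e2]

theorem block_shift_iterate (k : ℕ) (i : ℤ) (n : ℕ) :
    block (shift^[k] p) i n = block p (i + k) n := by
  rw [shift_iterate]
  rw [block_eq, block_eq]
  refine List.map_congr_left fun j _ => ?_
  rw [add_right_comm]

end block

/-- The periodic sequence with a given period word. -/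
def per (b : List FibEdge) (i : ℤ) : FibEdge := (b[(i % b.length).toNat]?).getD .neg0

theorem per_periodic (b : List FibEdge) (i : ℤ) : per b (i + b.length) = per b i := by
  simp [per]

theorem block_per (b : List FibEdge) : block (per b) 0 b.length = b := by
  refine List.ext_getElem (by simp) fun k h1 h2 => ?_
  have : ((k : ℤ) % (b.length : ℤ)).toNat = k := by
    rw [Int.emod_eq_of_lt (by positivity) (by exact_mod_cast h2)]
    simp
  simp [block_eq, per, this, h2]

theorem eq_per_block {p : ℤ → FibEdge} {n : ℕ} (hn : 1 ≤ n) (h : ∀ i, p (i + n) = p i) :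
    p = per (block p 0 n) := by
  funext i
  have h0 : 0 ≤ i % (n : ℤ) := Int.emod_nonneg _ (by omega)
  have h1 : i % (n : ℤ) < n := Int.emod_lt_of_pos _ (by omega)
  have h2 : (i % (n : ℤ)).toNat < n := by omega
  have h3 : p i = p (i % n) := by
    conv_lhs => rw [← Int.emod_add_ediv_mul i n]
    exact periodic_mul h _ _
  rw [h3]
  simp [per, block_eq, h2, Int.toNat_of_nonneg h0]

theorem per_injective {b c : List FibEdge} (hl : b.length = c.length) (h : per b = per c) :
    b = c := by
  rw [← block_per b, h, hl, block_per]

theorem shift_iterate_per (b c : List FibEdge) :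
    shift^[b.length] (per (b ++ c)) = per (c ++ b) := by
  rcases Nat.eq_zero_or_pos (b ++ c).length with h0 | h0
  · obtain ⟨rfl, rfl⟩ : b = [] ∧ c = [] := by simpa using h0
    rfl
  · have h1 := block_rotate (per_periodic (b ++ c)) 0 (block_per (b ++ c))
    rw [← block_shift_iterate] at h1
    rw [← h1]
    refine eq_per_block h0 fun i => ?_
    rw [shift_iterate]
    simp only
    rw [add_right_comm, per_periodic]

theorem isPeriodicPt_per (b : List FibEdge) : Function.IsPeriodicPt shift b.length (per b) :=
  isPeriodicPt_shift_iff.2 (per_periodic b)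

theorem per_mem_periodicPts {b : List FibEdge} (hb : b ≠ []) :
    per b ∈ Function.periodicPts shift :=
  ⟨b.length, List.length_pos_iff.2 hb, isPeriodicPt_per b⟩

/-- The orbit of the periodic sequence with a given period word. -/
noncomputable def orbit (b : List FibEdge) : Cycle (ℤ → FibEdge) :=
  Function.periodicOrbit shift (per b)

theorem orbit_append_comm (b c : List FibEdge) : orbit (c ++ b) = orbit (b ++ c) := by
  rcases eq_or_ne (b ++ c) [] with h0 | h0
  · obtain ⟨rfl, rfl⟩ : b = [] ∧ c = [] := by simpa using h0
    rfl
  · rw [orbit, ← shift_iterate_per]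
    exact Function.periodicOrbit_apply_iterate_eq (per_mem_periodicPts h0) _

theorem orbit_eq_of_isRotated {s t : List Tok} (h : s ~r t) : orbit (enc s) = orbit (enc t) := by
  obtain ⟨s1, s2, rfl, rfl⟩ := isRotated_iff_append.1 h
  simp [orbit_append_comm]

theorem orbit_block {p : ℤ → FibEdge} {n : ℕ} (hn : 1 ≤ n) (h : ∀ i, p (i + n) = p i) (i : ℤ) :
    orbit (block p i n) = Function.periodicOrbit shift p := by
  have hp : p ∈ Function.periodicPts shift := ⟨n, hn, isPeriodicPt_shift_iff.2 h⟩
  obtain ⟨k, hk⟩ : ∃ k : ℕ, (k : ℤ) = i % n :=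
    ⟨(i % n).toNat, Int.toNat_of_nonneg (Int.emod_nonneg _ (by omega))⟩
  have hb : block p i n = block (shift^[k] p) 0 n := by
    rw [block_shift_iterate, zero_add, hk]
    conv_lhs => rw [← Int.emod_add_ediv_mul i n]
    exact block_periodic h _ _ _
  have hq : ∀ j, shift^[k] p (j + n) = shift^[k] p j := fun j => by
    rw [shift_iterate]
    simp only
    rw [add_right_comm, h]
  rw [orbit, hb, ← eq_per_block hn hq]
  exact Function.periodicOrbit_apply_iterate_eq hp k

theorem exists_iterate_of_periodicOrbit_eq {α : Type*} {f : α → α} {x y : α}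
    (hx : x ∈ Function.periodicPts f) (hy : y ∈ Function.periodicPts f)
    (h : Function.periodicOrbit f x = Function.periodicOrbit f y) : ∃ k, f^[k] x = y := by
  have := Function.self_mem_periodicOrbit hy
  rw [← h] at this
  exact (Function.mem_periodicOrbit_iff hx).1 this

/-! ### Periodic orbits with negative multiplier and token lists -/

/-- The period is cut just after its first unmatched push. Tokens with empty `val` alone would leave
no symbol on the stack, and a nontrivial coincidence of rotated token lists would give a period
smaller than the minimal one. -/
theorem exists_good {p : ℤ → FibEdge} {n : ℕ} (hn : 1 ≤ n) (hp : p ∈ fibDyck.periodicPoints n)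
    {i : ℤ} {w : List (Fin 2)} (hw : w ≠ []) (h : fibDyck.periodLabel p i = negProd w) :
    ∃ s, Good n s ∧ orbit (enc s) = Function.periodicOrbit shift p ∧
      ((∀ a ∈ w, a = 0) → ∀ x ∈ s, x.isY = false) := by
  obtain ⟨hps, hpp, hmin⟩ := hp
  have hper : ∀ j, p (j + n) = p j :=
    isPeriodicPt_shift_iff.1 (hmin ▸ Function.isPeriodicPt_minimalPeriod shift p)
  rw [LabelledGraph.periodLabel, hmin] at h
  obtain ⟨m, rfl⟩ : ∃ m, n = m + 1 := ⟨n - 1, by omega⟩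
  have hact := stackHom_negProd w []
  rw [← h] at hact
  obtain ⟨v', hrun, hlast⟩ := run_of_isPath (hps i (m + 1)).1 (v := fibDyck.source (p i))
    (by simp [block_succ]) hact
  have hv' : v' = fibDyck.source (p i) := by
    rw [← hlast (p (i + m)) (by rw [block_add]; simp [block_eq])]
    -- The two-edge path across the end of the period shows that the block is closed.
    have h2 := (hps (i + m) 2).1
    rw [show block p (i + m) 2 = [p (i + m), p (i + m + 1)] by simp [block_eq, List.range_succ]] at h2
    rw [← hper i]
    simpa [LabelledGraph.IsPath, add_assoc] using h2
  obtain ⟨a, w, rfl⟩ := List.exists_cons_of_ne_nil hw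
  rw [List.append_nil, List.reverse_cons] at hrun
  obtain ⟨b1, e, b2, v1, hb, h1, h2, h3⟩ := exists_unmatched hrun
  -- The symbol `a` was at the bottom of the stack; after the rotation its push comes last, so it is
  -- now on top.
  have hrun' : run (b2 ++ (b1 ++ [e])) (0, []) = some (0, a :: w.reverse) := by
    have h4 : step e (v1, w.reverse) = some (0, a :: w.reverse) := step_stack h2 w.reverse
    simp [run_append, h3, hv', run_stack_nil h1, h4]
  obtain ⟨s, hs⟩ := exists_enc _ _ hrun'
  have hval : (s.flatMap Tok.val).reverse = a :: w.reverse := by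
    have := run_enc s []
    rw [hs, hrun'] at this
    simpa using this.symm
  have hlen : (enc s).length = m + 1 := by
    have := congrArg List.length hb
    simp [hs] at this ⊢
    omega
  have horb : orbit (enc s) = Function.periodicOrbit shift p := by
    rw [← orbit_block hn hper i, hb, hs, show b1 ++ e :: b2 = (b1 ++ [e]) ++ b2 by simp]
    exact orbit_append_comm _ _
  refine ⟨s, ⟨hlen, ?_, ?_⟩, horb, ?_⟩
  · by_contra! hne
    have : s.flatMap Tok.val = [] := List.flatMap_eq_nil_iff.2 fun x hx => by
      have := hne x hx
      cases x <;> simp_all [Tok.isA, Tok.isY, Tok.val]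
    rw [this] at hval
    cases hval
  · intro s1 s2 e1 e2
    by_contra! hne
    have h4 := shift_iterate_per (enc s1) (enc s2)
    rw [← enc_append, ← enc_append, e2, ← e1] at h4
    have h5 : Function.minimalPeriod shift (per (enc s)) = m + 1 := by
      have := congrArg Cycle.length horb
      rwa [orbit, Function.periodicOrbit_length, Function.periodicOrbit_length, hmin] at this
    have h6 : Function.minimalPeriod shift (per (enc s)) ∣ (enc s1).length :=
      Function.IsPeriodicPt.minimalPeriod_dvd h4
    have hpos : ∀ {t : List Tok}, t ≠ [] → 0 < (enc t).length := by
      intro t ht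
      obtain ⟨x, t, rfl⟩ := List.exists_cons_of_ne_nil ht
      have := List.length_pos_iff.2 x.enc_ne_nil
      simp; omega
    have h7 := Nat.le_of_dvd (hpos hne.1) h6
    have h8 := hpos hne.2
    rw [e1, enc_append, List.length_append] at hlen
    omega
  · intro hz x hx
    cases x with
    | Y l =>
      have : (1 : Fin 2) ∈ (s.flatMap Tok.val).reverse := by
        rw [List.mem_reverse, List.mem_flatMap]
        exact ⟨_, hx, by simp [Tok.val]⟩
      rw [hval] at this
      have h1 := hz 1 (by simpa using this)
      cases h1
    | _ => rfl

/-- The word can be run again and again, each run working above what the earlier ones left. Up to a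
multiple of the period, every block is a factor of such a power, whose label is a nonzero product of
`α₋`'s. -/
theorem mem_shiftSpace_of_run {b : List FibEdge} (hb : b ≠ []) {u : List (Fin 2)}
    (h : run b (0, []) = some (0, u)) : per b ∈ fibDyck.shiftSpace := by
  have hpow : ∀ k : ℕ, ∃ u', run (block (per b) 0 (k * b.length)) (0, []) = some (0, u') := by
    intro k
    induction k with
    | zero => exact ⟨[], by simp [block_eq]⟩
    | succ k ih =>
      obtain ⟨u', hu'⟩ := ih
      have := block_periodic (per_periodic b) 0 k b.length
      rw [block_per] at this
      rw [add_mul, one_mul, block_add, run_append, hu', Nat.cast_mul, this]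
      exact ⟨_, run_stack_nil h u'⟩
  have hl : 1 ≤ b.length := List.length_pos_iff.2 hb
  have main : ∀ j m : ℕ, fibDyck.IsPath (block (per b) j m) ∧
      fibDyck.labelWord (block (per b) j m) ≠ 0 := by
    intro j m
    obtain ⟨u', hu'⟩ := hpow (j + m)
    obtain ⟨r, hr⟩ : ∃ r, (j + m) * b.length = j + m + r :=
      Nat.exists_eq_add_of_le (Nat.le_mul_of_pos_right _ hl)
    have hpath := isPath_of_run hu'
    have hlab := labelWord_of_run hu'
    rw [hr, block_add, block_add, zero_add] at hpath hlab
    refine ⟨List.IsChain.right_of_append (List.IsChain.left_of_append hpath), fun h0 => ?_⟩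
    have : fibDyck.labelWord (block (per b) 0 j ++ block (per b) j m ++
        block (per b) (0 + (j + m : ℕ)) r) = 0 := by
      have e : ∀ x y : List FibEdge, fibDyck.labelWord (x ++ y) =
        fibDyck.labelWord x * fibDyck.labelWord y := by simp [LabelledGraph.labelWord]
      rw [e, e, h0, mul_zero, zero_mul]
    exact negProd_ne_zero _ (hlab.symm.trans this)
  intro i m
  obtain ⟨j, hj⟩ : ∃ j : ℕ, (j : ℤ) = i % b.length :=
    ⟨(i % b.length).toNat, Int.toNat_of_nonneg (Int.emod_nonneg _ (by omega))⟩
  have := main j m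
  rwa [hj, ← block_periodic (per_periodic b) (i % b.length) (i / b.length),
    Int.emod_add_ediv_mul] at this

theorem Good.enc_ne_nil {n : ℕ} (hn : 1 ≤ n) {s : List Tok} (h : Good n s) : enc s ≠ [] := by
  rw [← List.length_pos_iff, h.length_eq]
  exact hn

/-- A smaller period would make a proper rotation fix the word; by `enc_rotate` it would be a proper
rotation of tokens, against primitivity. -/
theorem Good.minimalPeriod {n : ℕ} (hn : 1 ≤ n) {s : List Tok} (h : Good n s) :
    Function.minimalPeriod shift (per (enc s)) = n := by
  have hpt := isPeriodicPt_per (enc s)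
  rw [h.length_eq] at hpt
  have hpos := hpt.minimalPeriod_pos hn
  refine le_antisymm (hpt.minimalPeriod_le hn) ?_
  by_contra! hlt
  set m := Function.minimalPeriod shift (per (enc s)) with hm
  have hbc : enc s = (enc s).take m ++ (enc s).drop m := (List.take_append_drop _ _).symm
  have hlen : ((enc s).take m).length = m := by
    rw [List.length_take, h.length_eq]
    omega
  have h1 := shift_iterate_per ((enc s).take m) ((enc s).drop m)
  rw [← hbc, hlen, hm, Function.isPeriodicPt_minimalPeriod shift (per (enc s)), ← hm] at h1
  have h2 := per_injective (by simp [h.length_eq]; omega) h1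
  obtain ⟨s1, s2, e1, e2, e3, e4⟩ := enc_rotate hbc h2
  rcases h.prim s1 s2 e1 e2.symm with rfl | rfl
  · rw [← e3] at hlen
    simp at hlen
    omega
  · have := congrArg List.length e4
    simp [h.length_eq] at this
    omega

theorem Good.mem_periodicPoints {n : ℕ} (hn : 1 ≤ n) {s : List Tok} (h : Good n s) :
    per (enc s) ∈ fibDyck.periodicPoints n :=
  ⟨mem_shiftSpace_of_run (h.enc_ne_nil hn) (run_enc s []),
    per_mem_periodicPts (h.enc_ne_nil hn), h.minimalPeriod hn⟩

theorem Good.periodLabel {n : ℕ} (hn : 1 ≤ n) {s : List Tok} (h : Good n s) :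
    fibDyck.periodLabel (per (enc s)) 0 = negProd (s.flatMap Tok.val) := by
  rw [LabelledGraph.periodLabel, h.minimalPeriod hn, ← h.length_eq, block_per,
    labelWord_of_run (run_enc s [])]
  simp

theorem Good.isRotated {n : ℕ} (hn : 1 ≤ n) {s s' : List Tok} (h : Good n s) (h' : Good n s')
    (ho : orbit (enc s) = orbit (enc s')) : s ~r s' := by
  obtain ⟨k, hk⟩ := exists_iterate_of_periodicOrbit_eq (per_mem_periodicPts (h.enc_ne_nil hn))
    (per_mem_periodicPts (h'.enc_ne_nil hn)) ho
  rw [← Function.iterate_mod_minimalPeriod_eq, h.minimalPeriod hn] at hk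
  have hlt : k % n < n := Nat.mod_lt _ hn
  set m := k % n
  have hbc : enc s = (enc s).take m ++ (enc s).drop m := (List.take_append_drop _ _).symm
  have hlen : ((enc s).take m).length = m := by
    rw [List.length_take, h.length_eq]
    omega
  have h1 := shift_iterate_per ((enc s).take m) ((enc s).drop m)
  rw [← hbc, hlen, hk] at h1
  have h2 := per_injective (by simp [h.length_eq, h'.length_eq]; omega) h1
  obtain ⟨s1, s2, e1, e2, -, -⟩ := enc_rotate hbc h2
  exact isRotated_iff_append.2 ⟨s1, s2, e1, e2⟩

theorem Good.flatMap_val_ne_nil {n : ℕ} {s : List Tok} (h : Good n s) :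
    s.flatMap Tok.val ≠ [] := by
  intro h0
  obtain ⟨x, hx, hv⟩ := h.exists_val
  have := List.flatMap_eq_nil_iff.1 h0 x hx
  cases x <;> simp_all [Tok.isA, Tok.isY, Tok.val]

theorem Good.orbit_mem_orbitsNeg {n : ℕ} (hn : 1 ≤ n) {s : List Tok} (h : Good n s) :
    orbit (enc s) ∈ fibDyck.orbitsNeg n :=
  ⟨per (enc s), ⟨h.mem_periodicPoints hn, 0,
    mem_negPart_iff.2 ⟨_, h.flatMap_val_ne_nil, h.periodLabel hn⟩⟩, rfl⟩

theorem exists_good_of_mem_orbitsNeg {n : ℕ} (hn : 1 ≤ n) {o : Cycle (ℤ → FibEdge)}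
    (ho : o ∈ fibDyck.orbitsNeg n) : ∃ s, Good n s ∧ orbit (enc s) = o := by
  obtain ⟨p, ⟨hp, i, hi⟩, rfl⟩ := ho
  obtain ⟨w, hw, h⟩ := mem_negPart_iff.1 hi
  obtain ⟨s, h1, h2, -⟩ := exists_good hn hp hw h
  exact ⟨s, h1, h2⟩

theorem isRep_alpha_iff {N : ℕ} {n : Fin N} {w : List (Fin N)} :
    (alpha n).IsRep w ↔ w = [n] := by
  rw [Multiplier.IsRep, alpha, Cycle.coe_eq_coe, List.isRotated_singleton_iff]

theorem exists_good_of_mem_orbitsNegMultiplier {n : ℕ} (hn : 1 ≤ n) {o : Cycle (ℤ → FibEdge)}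
    (ho : o ∈ fibDyck.orbitsNegMultiplier n (alpha 0)) :
    ∃ s, Good n s ∧ orbit (enc s) = o ∧ ∀ x ∈ s, x.isY = false := by
  obtain ⟨p, ⟨hp, i, w, k, hw, hk, h⟩, rfl⟩ := ho
  obtain rfl := isRep_alpha_iff.1 hw
  rw [← negProd_flatten_replicate] at h
  obtain ⟨s, h1, h2, h3⟩ := exists_good hn hp (by simp; omega) h
  exact ⟨s, h1, h2, h3 (by simp)⟩

theorem Good.orbit_mem_orbitsNegMultiplier {n : ℕ} (hn : 1 ≤ n) {s : List Tok} (h : Good n s)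
    (hY : ∀ x ∈ s, x.isY = false) :
    orbit (enc s) ∈ fibDyck.orbitsNegMultiplier n (alpha 0) := by
  have hz : s.flatMap Tok.val = List.replicate (s.flatMap Tok.val).length 0 := by
    refine List.eq_replicate_iff.2 ⟨rfl, fun a ha => ?_⟩
    obtain ⟨x, hx, hax⟩ := List.mem_flatMap.1 ha
    have := hY x hx
    cases x <;> simp_all [Tok.isY, Tok.val]
  refine ⟨per (enc s), ⟨h.mem_periodicPoints hn, 0, [0], (s.flatMap Tok.val).length,
    isRep_alpha_iff.2 rfl, List.length_pos_iff.2 h.flatMap_val_ne_nil, ?_⟩, rfl⟩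
  rw [h.periodLabel hn, ← negProd_flatten_replicate, hz]
  simp

/-! ### Multipliers other than `α(0)` and the injection on orbits -/

theorem exists_primitive_root {A : Type*} (v : List A) (hv : v ≠ []) :
    ∃ (w : List A) (k : ℕ), IsPrimitive w ∧ 1 ≤ k ∧ v = (List.replicate k w).flatten := by
  induction hn : v.length using Nat.strong_induction_on generalizing v with
  | _ n ih =>
  by_cases hp : IsPrimitive v
  · exact ⟨v, 1, hp, le_rfl, by simp⟩
  · simp only [IsPrimitive, not_forall] at hp
    obtain ⟨u, k, hk, hk1⟩ := hp
    have hk0 : k ≠ 0 := by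
      rintro rfl
      simp at hk
      exact hv hk
    have hu : u ≠ [] := by
      rintro rfl
      apply hv
      simp [hk]
    have hlen : v.length = k * u.length := by simp [hk]
    have hlt : u.length < n := by
      have := List.length_pos_iff.2 hu
      have : 2 * u.length ≤ k * u.length := Nat.mul_le_mul_right _ (by omega)
      omega
    obtain ⟨w, j, h1, h2, h3⟩ := ih _ hlt u hu rfl
    refine ⟨w, k * j, h1, Nat.mul_pos (by omega) h2, ?_⟩
    have : ∀ k : ℕ, (List.replicate k u).flatten = (List.replicate (k * j) w).flatten := by
      intro k
      induction k with
      | zero => simp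
      | succ k ihk =>
        rw [List.replicate_succ', List.flatten_append, ihk, add_mul, one_mul,
          List.replicate_add, List.flatten_append, ← h3]
        simp
    rw [hk, this]

/-- The multiplier is the class of the primitive root of the word of unmatched symbols. A `Y` puts
the symbol `1` into that word, so the root is not `[0]`. -/
theorem Good.orbit_mem_iUnion {n : ℕ} (hn : 1 ≤ n) {s : List Tok} (h : Good n s)
    (hY : ∃ x ∈ s, x.isY = true) :
    orbit (enc s) ∈ ⋃ μ ∈ {μ : Multiplier 2 | μ ≠ alpha 0}, fibDyck.orbitsNegMultiplier n μ := by
  obtain ⟨w, k, h1, h2, h3⟩ := exists_primitive_root _ h.flatMap_val_ne_nil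
  rw [Set.mem_iUnion₂]
  refine ⟨⟨(w : Cycle (Fin 2)), w, h1, rfl⟩, fun he => ?_, per (enc s),
    ⟨h.mem_periodicPoints hn, 0, w, k, rfl, h2, ?_⟩, rfl⟩
  · have hw : w = [0] := isRep_alpha_iff.1 (congrArg Subtype.val he)
    subst hw
    obtain ⟨x, hx, hxY⟩ := hY
    have : (1 : Fin 2) ∈ s.flatMap Tok.val := by
      refine List.mem_flatMap.2 ⟨x, hx, ?_⟩
      cases x <;> simp_all [Tok.isY, Tok.val]
    rw [h3] at this
    simp at this
  · rw [h.periodLabel hn, h3, negProd_flatten_replicate]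

theorem exists_injection {n : ℕ} (hn : 1 ≤ n) (h1 : n ≠ 1) (h3 : n ≠ 3) (h5 : n ≠ 5) :
    ∃ η : Cycle (ℤ → FibEdge) → Cycle (ℤ → FibEdge),
      Set.InjOn η (fibDyck.orbitsNegMultiplier n (alpha 0)) ∧
      ∀ o ∈ fibDyck.orbitsNegMultiplier n (alpha 0),
        ∃ s, Good n s ∧ (∃ x ∈ s, x.isY = true) ∧ η o = orbit (enc s) := by
  have key : ∀ o : Cycle (ℤ → FibEdge), ∃ t s : List Tok,
      o ∈ fibDyck.orbitsNegMultiplier n (alpha 0) →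
        orbit (enc t) = o ∧ Img t s ∧ Good n s := by
    intro o
    by_cases ho : o ∈ fibDyck.orbitsNegMultiplier n (alpha 0)
    · obtain ⟨t, ht, rfl, hY⟩ := exists_good_of_mem_orbitsNegMultiplier hn ho
      obtain ⟨t', s, hr, hi, hs⟩ := exists_img h1 h3 h5 ht hY
      exact ⟨t', s, fun _ => ⟨(orbit_eq_of_isRotated hr).symm, hi, hs⟩⟩
    · exact ⟨[], [], fun h => absurd h ho⟩
  choose t s h using key
  refine ⟨fun o => orbit (enc (s o)), fun o ho o' ho' he => ?_, fun o ho =>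
    ⟨s o, (h o ho).2.2, (h o ho).2.1.exists_isY, rfl⟩⟩
  obtain ⟨e1, i1, g1⟩ := h o ho
  obtain ⟨e2, i2, g2⟩ := h o' ho'
  rw [← e1, ← e2]
  exact orbit_eq_of_isRotated (i1.injective i2 (g1.isRotated hn g2 he))

/-! ### Time reversal -/

open MulOpposite

/-- The anti-automorphism of the Dyck inverse monoid that exchanges `α₋(n)` and `α₊(n)`. -/
def antiHom (N : ℕ) : DyckMonoid N →* (DyckMonoid N)ᵐᵒᵖ :=
  DyckMonoid.lift
    (fun g => match g with
      | .neg n => op (alphaPos n)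
      | .pos n => op (alphaNeg n))
    (fun n => by rw [← op_mul, alphaNeg_mul_alphaPos_self, op_one])
    (fun n m h => by rw [← op_mul, alphaNeg_mul_alphaPos_of_ne h.symm, op_zero])

/-- The anti-automorphism, as a map of the Dyck inverse monoid to itself. -/
def anti {N : ℕ} (x : DyckMonoid N) : DyckMonoid N := (antiHom N x).unop

theorem anti_alphaNeg {N : ℕ} (n : Fin N) : anti (alphaNeg n) = alphaPos n := by
  rw [anti, antiHom, DyckMonoid.lift_alphaNeg, unop_op]

theorem anti_alphaPos {N : ℕ} (n : Fin N) : anti (alphaPos n) = alphaNeg n := by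
  rw [anti, antiHom, DyckMonoid.lift_alphaPos, unop_op]

theorem anti_zero {N : ℕ} : anti (0 : DyckMonoid N) = 0 := by
  rw [anti, antiHom, DyckMonoid.lift_zero, unop_zero]

theorem anti_one {N : ℕ} : anti (1 : DyckMonoid N) = 1 := by simp [anti]

theorem anti_mul {N : ℕ} (x y : DyckMonoid N) : anti (x * y) = anti y * anti x := by simp [anti]

theorem anti_pow {N : ℕ} (x : DyckMonoid N) (k : ℕ) : anti (x ^ k) = anti x ^ k := by simp [anti]

theorem anti_list_prod {N : ℕ} (l : List (DyckMonoid N)) :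
    anti l.prod = (l.map anti).reverse.prod := by
  induction l with
  | nil => exact anti_one
  | cons x l ih => simp [anti_mul, ih]

theorem anti_negProd {N : ℕ} (w : List (Fin N)) : anti (negProd w) = posProd w := by
  rw [negProd, posProd, anti_list_prod, List.map_map, ← List.map_reverse]
  simp only [Function.comp_def, anti_alphaNeg]

theorem anti_posProd {N : ℕ} (w : List (Fin N)) : anti (posProd w) = negProd w := by
  rw [negProd, posProd, anti_list_prod, List.map_map, ← List.map_reverse, List.reverse_reverse]
  simp only [Function.comp_def, anti_alphaPos]

theorem anti_mem_negPart {N : ℕ} {x : DyckMonoid N} (h : x ∈ posPart N) : anti x ∈ negPart N := by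
  induction h using Subsemigroup.closure_induction with
  | mem x hx =>
    obtain ⟨n, rfl⟩ := hx
    exact Subsemigroup.subset_closure ⟨n, (anti_alphaPos n).symm⟩
  | mul x y _ _ hx hy => exact anti_mul x y ▸ mul_mem hy hx

/-- The edge in the reversed copy of the graph. -/
def FibEdge.flip : FibEdge → FibEdge
  | neg0 => pos0
  | neg => pos
  | neg1 => pos1
  | pos0 => neg0
  | pos => neg
  | pos1 => neg1

theorem FibEdge.flip_flip (e : FibEdge) : e.flip.flip = e := by cases e <;> rfl

theorem source_flip (e : FibEdge) : fibDyck.source e.flip = fibDyck.target e := by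
  cases e <;> rfl

theorem target_flip (e : FibEdge) : fibDyck.target e.flip = fibDyck.source e := by
  cases e <;> rfl

theorem label_flip (e : FibEdge) : fibDyck.label e.flip = anti (fibDyck.label e) := by
  cases e <;> simp [FibEdge.flip, fibDyck, anti_alphaNeg, anti_alphaPos, anti_one]

/-- The reversed word. -/
def flipWord (b : List FibEdge) : List FibEdge := (b.map FibEdge.flip).reverse

theorem flipWord_flipWord (b : List FibEdge) : flipWord (flipWord b) = b := by
  simp [flipWord, Function.comp_def, FibEdge.flip_flip]

theorem labelWord_flipWord (b : List FibEdge) :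
    fibDyck.labelWord (flipWord b) = anti (fibDyck.labelWord b) := by
  rw [LabelledGraph.labelWord, LabelledGraph.labelWord, anti_list_prod, flipWord,
    List.map_reverse, List.map_map, List.map_map]
  congr 3
  exact funext label_flip

theorem isPath_flipWord {b : List FibEdge} (h : fibDyck.IsPath b) :
    fibDyck.IsPath (flipWord b) := by
  rw [LabelledGraph.IsPath, flipWord, List.isChain_reverse, List.isChain_map]
  refine List.IsChain.imp (fun e f hef => ?_) h
  rw [target_flip, source_flip, hef]

theorem labelWord_flipWord_ne_zero {b : List FibEdge} (h : fibDyck.labelWord b ≠ 0) :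
    fibDyck.labelWord (flipWord b) ≠ 0 := by
  intro h0
  have := labelWord_flipWord (flipWord b)
  rw [flipWord_flipWord, h0, anti_zero] at this
  exact h this

/-- The reversed sequence. -/
def rev (p : ℤ → FibEdge) : ℤ → FibEdge := fun i => (p (-i)).flip

theorem rev_rev (p : ℤ → FibEdge) : rev (rev p) = p := by
  funext i
  simp [rev, FibEdge.flip_flip]

theorem block_rev (p : ℤ → FibEdge) (i : ℤ) (n : ℕ) :
    block (rev p) i n = flipWord (block p (-i - n + 1) n) := by
  refine List.ext_getElem (by simp [flipWord]) fun k h1 h2 => ?_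
  have hk : k < n := by simpa using h1
  simp only [block_eq, flipWord, List.getElem_map, List.getElem_range, List.getElem_reverse,
    List.length_map, List.length_range, rev]
  congr 2
  omega

theorem isPeriodicPt_rev {n : ℕ} {p : ℤ → FibEdge} (h : Function.IsPeriodicPt shift n p) :
    Function.IsPeriodicPt shift n (rev p) := by
  rw [isPeriodicPt_shift_iff] at h ⊢
  intro i
  have := h (-(i + n))
  simp only [rev, ← this]
  congr 2
  ring

theorem minimalPeriod_rev (p : ℤ → FibEdge) :
    Function.minimalPeriod shift (rev p) = Function.minimalPeriod shift p :=
  Function.minimalPeriod_eq_minimalPeriod_iff.2 fun _ =>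
    ⟨fun h => rev_rev p ▸ isPeriodicPt_rev h, isPeriodicPt_rev⟩

theorem rev_mem_periodicPoints {n : ℕ} {p : ℤ → FibEdge} (h : p ∈ fibDyck.periodicPoints n) :
    rev p ∈ fibDyck.periodicPoints n := by
  obtain ⟨h1, ⟨m, hm, h2⟩, h3⟩ := h
  refine ⟨fun i n => ?_, ⟨m, hm, isPeriodicPt_rev h2⟩, (minimalPeriod_rev p).trans h3⟩
  rw [block_rev]
  exact ⟨isPath_flipWord (h1 _ n).1, labelWord_flipWord_ne_zero (h1 _ n).2⟩

theorem exists_periodLabel_rev (p : ℤ → FibEdge) (i : ℤ) :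
    ∃ j, fibDyck.periodLabel (rev p) j = anti (fibDyck.periodLabel p i) := by
  refine ⟨-i - Function.minimalPeriod shift p + 1, ?_⟩
  rw [LabelledGraph.periodLabel, LabelledGraph.periodLabel, minimalPeriod_rev, block_rev,
    labelWord_flipWord]
  congr 3
  ring

theorem hasNeg_rev {p : ℤ → FibEdge} (h : fibDyck.HasPos p) : fibDyck.HasNeg (rev p) := by
  obtain ⟨i, hi⟩ := h
  obtain ⟨j, hj⟩ := exists_periodLabel_rev p i
  exact ⟨j, hj ▸ anti_mem_negPart hi⟩

theorem hasPosMultiplier_rev {p : ℤ → FibEdge} {μ : Multiplier 2}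
    (h : fibDyck.HasNegMultiplier μ p) : fibDyck.HasPosMultiplier μ (rev p) := by
  obtain ⟨i, w, k, hw, hk, hi⟩ := h
  obtain ⟨j, hj⟩ := exists_periodLabel_rev p i
  exact ⟨j, w, k, hw, hk, by rw [hj, hi, anti_pow, anti_negProd]⟩

theorem hasNegMultiplier_rev {p : ℤ → FibEdge} {μ : Multiplier 2}
    (h : fibDyck.HasPosMultiplier μ p) : fibDyck.HasNegMultiplier μ (rev p) := by
  obtain ⟨i, w, k, hw, hk, hi⟩ := h
  obtain ⟨j, hj⟩ := exists_periodLabel_rev p i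
  exact ⟨j, w, k, hw, hk, by rw [hj, hi, anti_pow, anti_posProd]⟩

/-- Reversal conjugates the shift to its inverse, so a shift carrying `rev p` to `rev q` carries `q`
to `p`. -/
theorem periodicOrbit_eq_of_rev {p q : ℤ → FibEdge} (hp : p ∈ Function.periodicPts shift)
    (hq : q ∈ Function.periodicPts shift)
    (h : Function.periodicOrbit shift (rev p) = Function.periodicOrbit shift (rev q)) :
    Function.periodicOrbit shift p = Function.periodicOrbit shift q := by
  have hr : ∀ {p}, p ∈ Function.periodicPts shift → rev p ∈ Function.periodicPts shift :=
    fun ⟨m, hm, h⟩ => ⟨m, hm, isPeriodicPt_rev h⟩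
  obtain ⟨k, hk⟩ := exists_iterate_of_periodicOrbit_eq (hr hp) (hr hq) h
  have : p = shift^[k] q := by
    rw [← rev_rev q, ← hk]
    funext i
    simp [shift_iterate, rev, FibEdge.flip_flip]
  rw [this]
  exact Function.periodicOrbit_apply_iterate_eq hq k

theorem encard_le_of_rev {n : ℕ} {S T : Set (ℤ → FibEdge)} (hS : S ⊆ fibDyck.periodicPoints n)
    (hST : ∀ p ∈ S, rev p ∈ T) :
    (Function.periodicOrbit shift '' S).encard ≤ (Function.periodicOrbit shift '' T).encard := by
  have : Nonempty FibEdge := ⟨.neg0⟩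
  choose! f hf using fun (o : Cycle (ℤ → FibEdge)) (ho : o ∈ Function.periodicOrbit shift '' S) =>
    ho
  refine Set.encard_le_encard_of_injOn (f := fun o => Function.periodicOrbit shift (rev (f o)))
    (fun o ho => ⟨_, hST _ (hf o ho).1, rfl⟩) fun o ho o' ho' h => ?_
  rw [← (hf o ho).2, ← (hf o' ho').2]
  exact periodicOrbit_eq_of_rev (hS (hf o ho).1).2.1 (hS (hf o' ho').1).2.1 h

theorem encard_orbitsPos_le (n : ℕ) :
    (fibDyck.orbitsPos n).encard ≤ (fibDyck.orbitsNeg n).encard :=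
  encard_le_of_rev (fun _ h => h.1) fun _ h => ⟨rev_mem_periodicPoints h.1, hasNeg_rev h.2⟩

theorem encard_orbitsPosMultiplier_le (n : ℕ) (μ : Multiplier 2) :
    (fibDyck.orbitsPosMultiplier n μ).encard ≤ (fibDyck.orbitsNegMultiplier n μ).encard :=
  encard_le_of_rev (fun _ h => h.1) fun _ h =>
    ⟨rev_mem_periodicPoints h.1, hasNegMultiplier_rev h.2⟩

theorem encard_orbitsNegMultiplier_le (n : ℕ) (μ : Multiplier 2) :
    (fibDyck.orbitsNegMultiplier n μ).encard ≤ (fibDyck.orbitsPosMultiplier n μ).encard :=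
  encard_le_of_rev (fun _ h => h.1) fun _ h =>
    ⟨rev_mem_periodicPoints h.1, hasPosMultiplier_rev h.2⟩

/-! ### Negative and positive multipliers exclude each other -/

/-- The change of the height of the stack. -/
def FibEdge.height : FibEdge → ℤ
  | neg0 => 1
  | neg => 0
  | neg1 => 1
  | pos0 => -1
  | pos => 0
  | pos1 => -1

theorem height_of_run {b : List FibEdge} {q q' : State} (h : run b q = some q') :
    (q'.2.length : ℤ) = q.2.length + (b.map FibEdge.height).sum := by
  induction b generalizing q with
  | nil =>
    obtain rfl : q = q' := by simpa using h
    simp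
  | cons e b ih =>
    obtain ⟨q1, h1, h2⟩ := Option.bind_eq_some_iff.1 h
    have hs : (q1.2.length : ℤ) = q.2.length + e.height := by
      obtain ⟨v, s⟩ := q
      cases e <;> cases s <;> simp [step] at h1 <;> grind [FibEdge.height]
    rw [ih h2, hs, List.map_cons, List.sum_cons]
    ring

theorem sum_height_block {p : ℤ → FibEdge} {n : ℕ} (h : ∀ i, p (i + n) = p i) (i : ℤ) :
    ((block p i n).map FibEdge.height).sum = ((block p 0 n).map FibEdge.height).sum := by
  -- Moving the window by one drops `p i` and appends `p (i + n) = p i`, so the sum does not change.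
  have hper : Function.Periodic (fun i => ((block p i n).map FibEdge.height).sum) 1 := by
    intro i
    have h1 := block_succ p i n
    have h2 := block_add p i n 1
    rw [h1, show block p (i + n) 1 = [p i] by simp [block_eq, h]] at h2
    have := congrArg (fun b => (b.map FibEdge.height).sum) h2
    simp only [List.map_cons, List.sum_cons, List.map_append, List.sum_append, List.map_nil,
      List.sum_nil] at this
    simp only
    linarith
  simpa using hper.int_mul i 0

/-- The run over a suitable period goes from the empty stack to a nonempty one. The sum of heights
does not depend on where the period starts, so its sign is an invariant of the orbit; `rev` changes
that sign. -/
theorem sum_height_pos {p : ℤ → FibEdge} {n : ℕ} (hp : p ∈ fibDyck.periodicPoints n)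
    (h : fibDyck.HasNeg p) : 0 < ((block p 0 n).map FibEdge.height).sum := by
  obtain ⟨i, hi⟩ := h
  obtain ⟨w, hw, hi⟩ := mem_negPart_iff.1 hi
  obtain ⟨hps, -, hmin⟩ := hp
  have hper : ∀ j, p (j + n) = p j :=
    isPeriodicPt_shift_iff.1 (hmin ▸ Function.isPeriodicPt_minimalPeriod shift p)
  rw [LabelledGraph.periodLabel, hmin] at hi
  have hact := stackHom_negProd w []
  rw [← hi] at hact
  obtain ⟨v', hrun, -⟩ := run_of_isPath (hps i n).1 (v := fibDyck.source (p i))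
    (by cases n <;> simp [block_succ, block_eq]) hact
  have := height_of_run hrun
  have hpos := List.length_pos_iff.2 hw
  simp only [List.append_nil, List.length_reverse, List.length_nil, Nat.cast_zero,
    zero_add] at this
  rw [← sum_height_block hper i, ← this]
  exact_mod_cast hpos

theorem sum_height_flipWord (b : List FibEdge) :
    ((flipWord b).map FibEdge.height).sum = -(b.map FibEdge.height).sum := by
  induction b with
  | nil => rfl
  | cons e b ih =>
    have : flipWord (e :: b) = flipWord b ++ [e.flip] := by simp [flipWord]
    rw [this, List.map_append, List.sum_append, ih]
    cases e <;> simp [FibEdge.flip, FibEdge.height]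

theorem disjoint_orbitsNeg_orbitsPos (n : ℕ) :
    Disjoint (fibDyck.orbitsNeg n) (fibDyck.orbitsPos n) := by
  rw [Set.disjoint_left]
  rintro o ⟨p, ⟨hp, hpn⟩, rfl⟩ ⟨q, ⟨hq, hqp⟩, hpq⟩
  have hper : ∀ {p}, p ∈ fibDyck.periodicPoints n → ∀ j, p (j + n) = p j := fun h =>
    isPeriodicPt_shift_iff.1 (h.2.2 ▸ Function.isPeriodicPt_minimalPeriod shift _)
  have h1 := sum_height_pos hp hpn
  have h2 := sum_height_pos (rev_mem_periodicPoints hq) (hasNeg_rev hqp)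
  rw [block_rev, sum_height_flipWord, sum_height_block (hper hq)] at h2
  obtain ⟨k, rfl⟩ := exists_iterate_of_periodicOrbit_eq hp.2.1 hq.2.1 hpq.symm
  rw [block_shift_iterate, sum_height_block (hper hp)] at h2
  linarith

theorem orbitsNegMultiplier_subset {n : ℕ} (hn : 1 ≤ n) :
    fibDyck.orbitsNegMultiplier n (alpha 0) ⊆ fibDyck.orbitsNeg n := by
  intro o ho
  obtain ⟨s, hs, rfl, -⟩ := exists_good_of_mem_orbitsNegMultiplier hn ho
  exact hs.orbit_mem_orbitsNeg hn

theorem orbitsPosMultiplier_subset (n : ℕ) :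
    fibDyck.orbitsPosMultiplier n (alpha 0) ⊆ fibDyck.orbitsPos n := by
  rintro o ⟨p, ⟨hp, i, w, k, hw, hk, h⟩, rfl⟩
  refine ⟨p, ⟨hp, i, ?_⟩, rfl⟩
  obtain rfl := isRep_alpha_iff.1 hw
  have hmem : ∀ k : ℕ, posProd [(0 : Fin 2)] ^ (k + 1) ∈ posPart 2 := by
    intro k
    have h0 : posProd [(0 : Fin 2)] ∈ posPart 2 :=
      Subsemigroup.subset_closure ⟨0, by simp [posProd]⟩
    induction k with
    | zero => simpa using h0
    | succ k ih =>
      rw [pow_succ]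
      exact mul_mem ih h0
  obtain ⟨k, rfl⟩ : ∃ j, k = j + 1 := ⟨k - 1, by omega⟩
  exact h ▸ hmem k

theorem not_isExceptionalAt {n : ℕ} (hn : 1 ≤ n) (h1 : n ≠ 1) (h3 : n ≠ 3) (h5 : n ≠ 5) :
    ¬ fibDyck.IsExceptionalAt (alpha 0) n := by
  obtain ⟨η, hinj, hη⟩ := exists_injection hn h1 h3 h5
  set O := fibDyck.orbitsNegMultiplier n (alpha 0) with hO
  rw [LabelledGraph.IsExceptionalAt, gt_iff_lt, not_lt]
  have hdisj : Disjoint O (η '' O) := by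
    rw [Set.disjoint_left]
    rintro _ ho ⟨o, ho', rfl⟩
    obtain ⟨s, hs, ⟨x, hx, hxY⟩, he⟩ := hη o ho'
    obtain ⟨t, ht, hte, hY⟩ := exists_good_of_mem_orbitsNegMultiplier hn ho
    have := (ht.isRotated hn hs (hte.trans he)).mem_iff.2 hx
    simp [hY x this] at hxY
  have hsub : O ∪ η '' O ⊆ fibDyck.orbitsNeg n := by
    rintro _ (ho | ⟨o, ho, rfl⟩)
    · exact orbitsNegMultiplier_subset hn ho
    · obtain ⟨s, hs, -, he⟩ := hη o ho
      exact he ▸ hs.orbit_mem_orbitsNeg hn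
  calc (O ∪ fibDyck.orbitsPosMultiplier n (alpha 0)).encard
      ≤ O.encard + (fibDyck.orbitsPosMultiplier n (alpha 0)).encard := Set.encard_union_le _ _
    _ ≤ O.encard + (η '' O).encard := by
        rw [hinj.encard_image]
        exact add_le_add le_rfl (encard_orbitsPosMultiplier_le n _)
    _ = (O ∪ η '' O).encard := (Set.encard_union_eq hdisj).symm
    _ ≤ (fibDyck.orbitsNeg n).encard := Set.encard_le_encard hsub
    _ ≤ _ := le_max_left _ _

/-! ### The periods `1`, `3`, `5` -/

theorem exists_good_of_run {b : List FibEdge} {u : List (Fin 2)}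
    (h : run b (0, []) = some (0, u)) (hu : u ≠ []) (hz : ∀ a ∈ u, a = 0)
    (hprim : ∀ d < b.length, 0 < d → b.rotate d ≠ b) :
    ∃ s, Good b.length s ∧ enc s = b ∧ ∀ x ∈ s, x.isY = false := by
  obtain ⟨s, rfl⟩ := exists_enc b u h
  obtain rfl : (s.flatMap Tok.val).reverse = u := by
    rw [run_enc] at h
    simpa using h
  refine ⟨s, ⟨rfl, ?_, fun s1 s2 e1 e2 => ?_⟩, rfl, fun x hx => ?_⟩
  · by_contra! hne
    refine hu (List.reverse_eq_nil_iff.2 (List.flatMap_eq_nil_iff.2 fun x hx => ?_))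
    have := hne x hx
    cases x <;> simp_all [Tok.isA, Tok.isY, Tok.val]
  · by_contra! hne
    have hpos : ∀ {t : List Tok}, t ≠ [] → 0 < (enc t).length := by
      intro t ht
      obtain ⟨x, t, rfl⟩ := List.exists_cons_of_ne_nil ht
      have := List.length_pos_iff.2 x.enc_ne_nil
      simp; omega
    refine hprim (enc s1).length ?_ (hpos hne.1) ?_
    · have := hpos hne.2
      simp [e1]
      omega
    · conv_rhs => rw [← e2]
      rw [e1, enc_append, enc_append, List.rotate_append_length_eq]
  · cases x with
    | Y l =>
      have := hz 1 (by
        rw [List.mem_reverse, List.mem_flatMap]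
        exact ⟨_, hx, by simp [Tok.val]⟩)
      cases this
    | _ => rfl

/-- The hypotheses are phrased as finite checks on words, with the bound `k < n + 1` making the
number of unmatched symbols decidable by search. Words that are not rotations of each other give
different orbits. -/
theorem le_encard_orbitsNegMultiplier {n : ℕ} (hn : 1 ≤ n) (L : List (List FibEdge))
    (h : ∀ b ∈ L, b.length = n ∧ (∃ k < n + 1, k ≠ 0 ∧
      run b (0, []) = some (0, List.replicate k 0)) ∧ ∀ d < n, 0 < d → b.rotate d ≠ b)
    (hL : L.Pairwise fun b c => ¬ b ~r c) :
    (L.length : ℕ∞) ≤ (fibDyck.orbitsNegMultiplier n (alpha 0)).encard := by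
  have hg : ∀ b ∈ L, ∃ s, Good n s ∧ enc s = b ∧ ∀ x ∈ s, x.isY = false := by
    intro b hb
    obtain ⟨rfl, ⟨k, -, hk, hr⟩, hp⟩ := h b hb
    exact exists_good_of_run hr (by simpa using hk) (by simp) hp
  have hnd : L.Nodup := hL.imp fun {a b} hab => by
    rintro rfl
    exact hab (List.IsRotated.refl _)
  have hinj : Set.InjOn orbit (L.toFinset : Set (List FibEdge)) := by
    intro b hb c hc hbc
    rw [Finset.mem_coe, List.mem_toFinset] at hb hc
    by_contra hne
    have hrot : b ~r c := by
      obtain ⟨s, hs, rfl, -⟩ := hg b hb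
      obtain ⟨t, ht, rfl, -⟩ := hg c hc
      obtain ⟨s1, s2, rfl, rfl⟩ := isRotated_iff_append.1 (hs.isRotated hn ht hbc)
      rw [enc_append, enc_append]
      exact List.isRotated_append
    have : Std.Symm fun b c : List FibEdge => ¬ b ~r c := ⟨fun _ _ h h' => h h'.symm⟩
    exact hL.forall hb hc hne hrot
  calc (L.length : ℕ∞) = (L.toFinset : Set (List FibEdge)).encard := by
        rw [Set.encard_coe_eq_coe_finsetCard, List.toFinset_card_of_nodup hnd]
    _ = (orbit '' (L.toFinset : Set (List FibEdge))).encard := hinj.encard_image.symm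
    _ ≤ _ := by
        refine Set.encard_le_encard ?_
        rintro _ ⟨b, hb, rfl⟩
        obtain ⟨s, hs, rfl, hY⟩ := hg b (by simpa using hb)
        exact hs.orbit_mem_orbitsNegMultiplier hn hY

/-- The words of a given length that run from a given state, with their final states. -/
def runs : ℕ → State → List (List FibEdge × State)
  | 0, q => [([], q)]
  | n + 1, q => [FibEdge.neg0, .neg, .neg1, .pos0, .pos, .pos1].flatMap fun e =>
      match step e q with
      | none => []
      | some q' => (runs n q').map fun r => (e :: r.1, r.2)

theorem mem_runs {b : List FibEdge} {q q' : State} (h : run b q = some q') :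
    (b, q') ∈ runs b.length q := by
  induction b generalizing q with
  | nil =>
    obtain rfl : q = q' := by simpa using h
    simp [runs]
  | cons e b ih =>
    obtain ⟨q1, h1, h2⟩ := Option.bind_eq_some_iff.1 h
    rw [List.length_cons, runs, List.mem_flatMap]
    refine ⟨e, by cases e <;> simp, ?_⟩
    rw [h1]
    exact List.mem_map.2 ⟨_, ih h2, rfl⟩

/-- For an upper bound any necessary condition on the words may be used. Rather than full
primitivity, only being fixed by rotation by one is excluded, which is all there is to exclude when
`n` is prime. -/
theorem encard_orbitsNeg_le {n : ℕ} (hn : 1 ≤ n) (M : List (List FibEdge))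
    (h : ∀ r ∈ runs n (0, []), r.2.1 = 0 → r.2.2 ≠ [] → (n = 1 ∨ r.1.rotate 1 ≠ r.1) →
      ∃ c ∈ M, r.1 ~r c) :
    (fibDyck.orbitsNeg n).encard ≤ M.length := by
  have hsub : fibDyck.orbitsNeg n ⊆ orbit '' (M.toFinset : Set (List FibEdge)) := by
    intro o ho
    obtain ⟨s, hs, rfl⟩ := exists_good_of_mem_orbitsNeg hn ho
    have hmem := mem_runs (run_enc s [])
    rw [hs.length_eq] at hmem
    obtain ⟨c, hc, hrot⟩ := h _ hmem rfl (by simpa using hs.flatMap_val_ne_nil) (by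
      by_contra! hne
      have hlen : 1 < (enc s).length := by rw [hs.length_eq]; omega
      obtain ⟨e, b, hb⟩ := List.exists_cons_of_ne_nil (hs.enc_ne_nil hn)
      have h1 : enc s = [e] ++ b := hb
      have h2 : enc s = b ++ [e] := by
        rw [← show (enc s).rotate 1 = enc s from hne.2]
        simp [hb]
      obtain ⟨s1, s2, e1, e2, e3, e4⟩ := enc_rotate h1 h2
      rcases hs.prim s1 s2 e1 e2.symm with rfl | rfl
      · simp at e3
      · rw [← e4] at hb
        simp [hb] at hlen)
    obtain ⟨x, y, hx, hy⟩ := isRotated_iff_append.1 hrot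
    exact ⟨c, by simpa using hc, by
      rw [hy, orbit_append_comm, ← hx]⟩
  calc _ ≤ _ := Set.encard_le_encard hsub
    _ ≤ (M.toFinset : Set (List FibEdge)).encard := Set.encard_image_le _ _
    _ ≤ _ := by
      rw [Set.encard_coe_eq_coe_finsetCard]
      exact_mod_cast M.toFinset_card_le

/-- Reversal doubles the count `k`, since the negative and positive orbits are disjoint, and it
transfers the bound `m` to the positive orbits. -/
theorem isExceptionalAt_of_card {n : ℕ} (hn : 1 ≤ n) {k m : ℕ} (hkm : m < 2 * k)
    (hk : (k : ℕ∞) ≤ (fibDyck.orbitsNegMultiplier n (alpha 0)).encard)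
    (hm : (fibDyck.orbitsNeg n).encard ≤ m) : fibDyck.IsExceptionalAt (alpha 0) n := by
  have hdisj : Disjoint (fibDyck.orbitsNegMultiplier n (alpha 0))
      (fibDyck.orbitsPosMultiplier n (alpha 0)) :=
    (disjoint_orbitsNeg_orbitsPos n).mono (orbitsNegMultiplier_subset hn)
      (orbitsPosMultiplier_subset n)
  rw [LabelledGraph.IsExceptionalAt, gt_iff_lt, Set.encard_union_eq hdisj]
  calc max (fibDyck.orbitsNeg n).encard (fibDyck.orbitsPos n).encard
      ≤ (m : ℕ∞) := max_le hm ((encard_orbitsPos_le n).trans hm)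
    _ < ((k + k : ℕ) : ℕ∞) := by
        rw [Nat.cast_lt]
        omega
    _ = (k : ℕ∞) + k := by push_cast; rfl
    _ ≤ _ := add_le_add hk (hk.trans (encard_orbitsNegMultiplier_le n _))

open FibEdge in
theorem isExceptionalAt_one : fibDyck.IsExceptionalAt (alpha 0) 1 :=
  isExceptionalAt_of_card (k := 1) (m := 1) le_rfl (by norm_num)
    (le_encard_orbitsNegMultiplier le_rfl [[neg0]] (by decide +kernel) (by decide +kernel))
    (encard_orbitsNeg_le le_rfl [[neg0]] (by decide +kernel))

open FibEdge in
theorem isExceptionalAt_three : fibDyck.IsExceptionalAt (alpha 0) 3 :=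
  isExceptionalAt_of_card (k := 2) (m := 3) (by norm_num) (by norm_num)
    (le_encard_orbitsNegMultiplier (by norm_num) [[neg0, neg0, pos0], [neg0, neg, pos]]
      (by decide +kernel) (by decide +kernel))
    (encard_orbitsNeg_le (by norm_num)
      [[neg0, neg0, pos0], [neg0, neg, pos], [neg0, neg, neg1]] (by decide +kernel))

open FibEdge in
/-- The words of the orbits of length `5` with multiplier `α₋(0)`. -/
def wordsZeroFive : List (List FibEdge) :=
  [[neg0, neg0, neg0, neg0, pos0], [neg0, neg0, neg0, neg, pos],
    [neg0, neg0, pos0, neg0, pos0], [neg0, neg0, pos0, neg, pos],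
    [neg0, neg, pos, neg0, pos0], [neg0, neg, pos, neg, pos],
    [neg0, neg0, neg0, pos0, pos0], [neg0, neg0, neg, pos, pos0],
    [neg0, neg, neg1, pos1, pos]]

open FibEdge in
/-- The words of the orbits of length `5` with a negative multiplier other than `α₋(0)`. -/
def wordsOtherFive : List (List FibEdge) :=
  [[neg0, neg0, neg0, neg, neg1], [neg0, neg0, pos0, neg, neg1],
    [neg0, neg, neg1, neg0, pos0], [neg0, neg, pos, neg, neg1],
    [neg0, neg, neg1, neg, pos], [neg0, neg, neg1, neg, neg1],
    [neg0, neg, neg1, pos1, neg1]]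

theorem isExceptionalAt_five : fibDyck.IsExceptionalAt (alpha 0) 5 :=
  isExceptionalAt_of_card (k := 9) (m := 16) (by norm_num) (by norm_num)
    (le_encard_orbitsNegMultiplier (by norm_num) wordsZeroFive
      (by decide +kernel) (by decide +kernel))
    (encard_orbitsNeg_le (by norm_num) (wordsZeroFive ++ wordsOtherFive) (by decide +kernel))

end FibDyck

theorem propositionM0 :
    (∀ n : ℕ, 1 ≤ n →
      (FibDyck.fibDyck.IsExceptionalAt (FibDyck.alpha 0) n ↔ n = 1 ∨ n = 3 ∨ n = 5)) ∧
    (∀ n : ℕ, 7 ≤ n →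
      ∃ η : Cycle (ℤ → FibDyck.FibEdge) → Cycle (ℤ → FibDyck.FibEdge),
        Set.InjOn η (FibDyck.fibDyck.orbitsNegMultiplier n (FibDyck.alpha 0)) ∧
        Set.MapsTo η (FibDyck.fibDyck.orbitsNegMultiplier n (FibDyck.alpha 0))
          (⋃ μ ∈ {μ : FibDyck.Multiplier 2 | μ ≠ FibDyck.alpha 0},
            FibDyck.fibDyck.orbitsNegMultiplier n μ)) := by
  refine ⟨fun n hn => ⟨fun h => ?_, ?_⟩, fun n hn => ?_⟩
  · by_contra! hne
    exact FibDyck.not_isExceptionalAt hn hne.1 hne.2.1 hne.2.2 h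
  · rintro (rfl | rfl | rfl)
    exacts [FibDyck.isExceptionalAt_one, FibDyck.isExceptionalAt_three,
      FibDyck.isExceptionalAt_five]
  · obtain ⟨η, h1, h2⟩ := FibDyck.exists_injection (n := n) (by omega) (by omega) (by omega)
      (by omega)
    refine ⟨η, h1, fun o ho => ?_⟩
    obtain ⟨s, hs, hY, he⟩ := h2 o ho
    exact he ▸ hs.orbit_mem_iUnion (by omega) hY
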